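/- Let $X_1,X_2,\dots$ be independent real random variables with common distribution function $F$, and let $X\sim F$ with $E(X^2)<\infty$. Let $t_0\in(0,1)$, let $\psi=\inf\{x:F(x)\ge t_0\}$ be the $t_0$-quantile of $F$, and assume that $F$ is continuous in a neighbourhood of $\psi$ and that $F(x)>t_0$ for every $x>\psi$. Put $$\theta=E[X\,1(X\le\psi)],\qquad \sigma_p^2=\mathrm{Var}\big(X\,1(X\le\psi)\big),\qquad \sigma_v^2=\mathrm{Var}\big((X-\psi)\,1(X\le\psi)\big)$$ (for $X\ge 0$, $\theta=\int_0^{\psi}x\,dF(x)$ is the generalized Lorenz ordinate at $t_0$). For $n\ge1$ let $\widehat F_n$ be the empirical distribution function of $X_1,\dots,X_n$, let $\widehat\psi=\inf\{x:\widehat F_n(x)\ge t_0\}$, let $\widehat W_i=X_i\,1(X_i\le\widehat\psi)-\theta$ for $1\le i\le n$, and let $$\mathcal R=\sup\Big\{\prod_{i=1}^n np_i:\ p_i\ge0,\ \sum_{i=1}^np_i=1,\ \sum_{i=1}^np_i\widehat W_i=0\Big\},\qquad \ell=-2\log\mathcal R\in[0,\infty],$$ where $\mathcal R=0$ if no such $p$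 exists and $-2\log 0=+\infty$. Let $$\ell_t=\ell\cdot\max\Big\{1-\frac{\ell}{n},\ \frac12\Big\}$$ be the transformed empirical log-likelihood ratio (with $\ell_t=+\infty$ if $\ell=+\infty$). Then $$\frac{\sigma_p^2}{\sigma_v^2}\,\ell_t\longrightarrow\chi^2_1\quad\text{in distribution as }n\to\infty,$$ as random variables with values in $[-\infty,\infty]$, where $\chi^2_1$ is the law of the square of a standard normal variable. -/

import Mathlib

open MeasureTheory ProbabilityTheory Filter
open scoped Topology ENNReal

noncomputable section

namespace LorenzEL

/-- The left-continuous generalized inverse `F⁻¹(t) = inf {x : F x ≥ t}`. -/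
def genInv (F : ℝ → ℝ) (t : ℝ) : ℝ := sInf {x : ℝ | t ≤ F x}

/-! ### Population quantities, for the law `ν` of `X` -/

/-- The `t`-quantile `ψ_t` of the law `ν`. -/
def quantile (ν : Measure ℝ) (t : ℝ) : ℝ := genInv (fun x => cdf ν x) t

/-- The generalized Lorenz ordinate `θ(t) = E[X · 1(X ≤ ψ_t)]`. -/
def lorenz (ν : Measure ℝ) (t : ℝ) : ℝ :=
  ∫ x, (Set.Iic (quantile ν t)).indicator (fun y => y) x ∂ν

/-- For a nonnegative variable, `θ(t)` is the integral of `x` over `[0, ψ_t]` against `dF`. -/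
theorem lorenz_eq_of_nonneg (ν : Measure ℝ) (t : ℝ) (h : ∀ᵐ x ∂ν, 0 ≤ x) :
    lorenz ν t = ∫ x in Set.Icc 0 (quantile ν t), x ∂ν := by
  unfold lorenz
  rw [← integral_indicator measurableSet_Icc]
  refine integral_congr_ae ?_
  filter_upwards [h] with x hx
  simp [Set.indicator, hx]

/-- `σ_p² = Var(X · 1(X ≤ ψ_t))`. -/
def sigmaPSq (ν : Measure ℝ) (t : ℝ) : ℝ :=
  variance ((Set.Iic (quantile ν t)).indicator (fun x => x)) ν

/-- `σ_v² = Var((X - ψ_t) · 1(X ≤ ψ_t))`. -/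
def sigmaVSq (ν : Measure ℝ) (t : ℝ) : ℝ :=
  variance ((Set.Iic (quantile ν t)).indicator (fun x => x - quantile ν t)) ν

/-! ### Sample quantities, for a sample `x = (x_1, …, x_n)` -/

open Classical in
/-- The empirical distribution function. -/
def empCdf {n : ℕ} (x : Fin n → ℝ) (y : ℝ) : ℝ :=
  ((Finset.univ.filter (fun i => x i ≤ y)).card : ℝ) / (n : ℝ)

/-- The `t`-th sample quantile. -/
def sampleQuantile {n : ℕ} (x : Fin n → ℝ) (t : ℝ) : ℝ := genInv (empCdf x) t

/-- `Ŵ_i = x_i · 1(x_i ≤ ψ̂_t) - θ`. -/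
def wHat {n : ℕ} (x : Fin n → ℝ) (t θ : ℝ) (i : Fin n) : ℝ :=
  (Set.Iic (sampleQuantile x t)).indicator (fun y => y) (x i) - θ

/-- The profile empirical likelihood of the constraint `∑ p_i w_i = 0`: the supremum of `∏ p_i`
over the probability vectors `p` that satisfy it (it is `0` if there is no such vector). -/
def empLik {n : ℕ} (w : Fin n → ℝ) : ℝ≥0∞ :=
  ⨆ p ∈ {p : Fin n → ℝ | p ∈ stdSimplex ℝ (Fin n) ∧ ∑ i, p i * w i = 0},
    ENNReal.ofReal (∏ i, p i)

/-- The empirical likelihood ratio: the likelihood divided by its unconstrained maximum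
`n⁻ⁿ`; that is, the supremum of `∏ (n p_i)`. -/
def elRatio {n : ℕ} (w : Fin n → ℝ) : ℝ≥0∞ := (n : ℝ≥0∞) ^ n * empLik w

/-- The empirical log-likelihood ratio `ℓ(θ) = -2 log R(θ)`, with value `+∞` when `R(θ) = 0`. -/
def logELRatio {n : ℕ} (x : Fin n → ℝ) (t θ : ℝ) : EReal :=
  -(2 * ENNReal.log (elRatio (wHat x t θ)))

/-- The transformed empirical log-likelihood ratio `ℓ_t = ℓ · max {1 - ℓ/n, 1/2}`
(which is `+∞` when `ℓ = +∞`). -/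
def transformedLogELRatio {n : ℕ} (x : Fin n → ℝ) (t θ : ℝ) : EReal :=
  logELRatio x t θ * max (1 - logELRatio x t θ / (n : EReal)) ((1 / 2 : ℝ) : EReal)

/-- The chi-squared distribution with one degree of freedom: the law of the square of a
standard normal variable. -/
def chiSquaredOne : Measure ℝ := (gaussianReal 0 1).map (fun z => z ^ 2)

instance : IsProbabilityMeasure chiSquaredOne :=
  Measure.isProbabilityMeasure_map (by fun_prop)

end LorenzEL

end

/-! Write `B = n^(-1/2) ∑ Ŵᵢ` and `A = n⁻¹ ∑ Ŵᵢ²`. The log-likelihood ratio is asymptotically `B² /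
A`, and the scale factor appears because the variance of the limit of `B` is not the limit of `A`.

The equation for the optimal Lagrange multiplier is never solved. Any multiplier bounds the ratio
from above by weak duality (`elRatio_le`), and explicit linearly tilted weights bound it from below
(`le_elRatio`). With good choices, the two bounds pinch `ℓ` around `B² / A` (`exists_logRatio_eq`),
provided that `max |Ŵᵢ| = o(√n)`; a second moment suffices for this (`tendsto_norm_wHat_div_sqrt`).

Estimating `ψ` leaves `A → σ_p²` unchanged (`tendsto_mean_wHat_sq`), but it does change the
fluctuations of `B`. There are almost surely no ties near `ψ`, so `F̂(ψ̂) = t + O(1/n)`, and `∑ Xᵢ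
1(Xᵢ ≤ ψ̂)` equals `∑ (Xᵢ - ψ) 1(Xᵢ ≤ ψ̂) + nψt` up to a bounded error. Replacing `ψ̂` by `ψ` in
this sum alters `O_P(√n)` terms, each by at most `|ψ̂ - ψ| = o_P(1)`. Hence `B` is asymptotically
the normalized sum of `(X - ψ) 1(X ≤ ψ)`, of variance `σ_v²` (`tendsto_sum_wHat_sub_normalizedSum`);
no density of `F` is needed.

Thus `ℓ` behaves like `N(0, σ_v²)² / σ_p²`, and the factor `max {1 - ℓ/n, 1/2}` tends to one
(`eventually_forcesClose`, `tendstoInDistribution_chiSquaredOne`). Stochastic orders are expressed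
through the filter `whp`: convergence in probability becomes `Tendsto` along it, and bounded second
moments play the role of tightness. -/

noncomputable section

namespace LorenzEL

/-! ### Events whose probability tends to one -/

/-- The filter of the families `(S_n)` of events with `P(S_n) → 1`, as sets of pairs `(n, ω)`. -/
def whp {Ω : Type*} [MeasurableSpace Ω] (P : Measure Ω) : Filter (ℕ × Ω) where
  sets := {S | Tendsto (fun n => P {ω | (n, ω) ∉ S}) atTop (𝓝 0)}
  univ_sets := by simp
  sets_of_superset := by
    intro S T hS hST
    exact tendsto_of_tendsto_of_tendsto_of_le_of_le tendsto_const_nhds hS (fun _ => zero_le)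
      (fun n => measure_mono fun ω hω hS' => hω (hST hS'))
  inter_sets := by
    intro S T hS hT
    have h := Tendsto.add hS hT
    rw [add_zero] at h
    refine tendsto_of_tendsto_of_tendsto_of_le_of_le tendsto_const_nhds h (fun _ => zero_le)
      (fun n => ?_)
    refine (measure_mono ?_).trans (measure_union_le _ _)
    intro ω hω
    by_contra hcon
    simp only [Set.mem_union, Set.mem_ofPred_eq, not_or, not_not] at hcon
    exact hω hcon

section whp

variable {Ω : Type*} [MeasurableSpace Ω] {P : Measure Ω}

lemma eventually_whp {p : ℕ × Ω → Prop} :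
    (∀ᶠ z in whp P, p z) ↔ Tendsto (fun n => P {ω | ¬ p (n, ω)}) atTop (𝓝 0) := Iff.rfl

lemma tendsto_fst_whp : Tendsto Prod.fst (whp P) atTop := by
  intro S hS
  refine eventually_whp.2 (tendsto_const_nhds.congr' ?_)
  filter_upwards [hS] with n hn
  simp [hn]

lemma eventually_whp_of_ae {p : ℕ × Ω → Prop} (h : ∀ᵐ ω ∂P, ∀ n, p (n, ω)) :
    ∀ᶠ z in whp P, p z := by
  refine eventually_whp.2 (tendsto_const_nhds.congr fun n => ?_)
  symm
  refine measure_mono_null ?_ h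
  intro ω hω hcon
  exact hω (hcon n)

lemma tendsto_whp_iff {f : ℕ → Ω → ℝ} {c : ℝ} :
    Tendsto (fun z : ℕ × Ω => f z.1 z.2) (whp P) (𝓝 c) ↔
      TendstoInMeasure P f atTop (fun _ => c) := by
  rw [tendstoInMeasure_iff_dist, Metric.tendsto_nhds]
  simp only [eventually_whp, not_lt]

lemma tendsto_whp_of_ae [IsFiniteMeasure P] {f : ℕ → Ω → ℝ} {c : ℝ}
    (hf : ∀ n, AEMeasurable (f n) P) (h : ∀ᵐ ω ∂P, Tendsto (fun n => f n ω) atTop (𝓝 c)) :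
    Tendsto (fun z : ℕ × Ω => f z.1 z.2) (whp P) (𝓝 c) :=
  tendsto_whp_iff.2 (tendstoInMeasure_of_tendsto_ae (fun n => (hf n).aestronglyMeasurable) h)

/-- If `Y` has bounded second moments and `q → q₀` in probability, then an event which holds for
`(q, Y)` near each point `(q₀, y)` holds with probability tending to one. -/
lemma eventually_whp_of_secondMoment [IsFiniteMeasure P] {E : Type*} [TopologicalSpace E]
    {q : ℕ × Ω → E} {q₀ : E} {Y : ℕ → Ω → ℝ} {C : ℝ} (hq : Tendsto q (whp P) (𝓝 q₀))
    (hY : ∀ n, 0 < n → MemLp (Y n) 2 P) (hC : ∀ n, 0 < n → ∫ ω, Y n ω ^ 2 ∂P ≤ C)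
    {R : E → ℝ → Prop} (hR : ∀ y, ∀ᶠ z : E × ℝ in 𝓝 (q₀, y), R z.1 z.2) :
    ∀ᶠ z in whp P, R (q z) (Y z.1 z.2) := by
  rw [eventually_whp, ENNReal.tendsto_atTop_zero]
  intro ε hε
  have hC0 : 0 ≤ C := (integral_nonneg fun ω => sq_nonneg (Y 1 ω)).trans (hC 1 one_pos)
  obtain ⟨δ, hδ, hδε⟩ : ∃ δ : ℝ, 0 < δ ∧ ENNReal.ofReal δ ≤ ε / 2 := by
    rcases eq_or_ne ε ∞ with rfl | hε'
    · exact ⟨1, one_pos, by simp [ENNReal.top_div]⟩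
    · exact ⟨(ε / 2).toReal, ENNReal.toReal_pos (by simp [hε.ne']) (by finiteness),
        ENNReal.ofReal_toReal_le⟩
  -- Truncation level for Markov's inequality applied to `Y²`; `k = 1 + C / δ` works because `(1 +
  -- s)² ≥ s`.
  obtain ⟨k, hk0, hk⟩ : ∃ k : ℝ, 0 < k ∧ C / k ^ 2 ≤ δ := by
    refine ⟨1 + C / δ, by positivity, ?_⟩
    rw [div_le_iff₀ (by positivity)]
    have h : C = δ * (C / δ) := by field_simp
    have h1 : 0 ≤ C / δ := by positivity
    nlinarith [mul_nonneg hδ.le h1, mul_nonneg hδ.le (sq_nonneg (C / δ))]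
  -- Compactness of `[-k, k]` turns the pointwise neighbourhoods in `hR` into one neighbourhood of
  -- `q₀` valid for all these `y`.
  have hev : ∀ᶠ z in whp P, ∀ y ∈ Set.Icc (-k) k, R (q z) y :=
    hq.eventually (isCompact_Icc.eventually_forall_of_forall_eventually fun y _ => hR y)
  rw [eventually_whp, ENNReal.tendsto_atTop_zero] at hev
  obtain ⟨N, hN⟩ := hev (ε / 2) (by simp [hε.ne'])
  refine ⟨max N 1, fun n hn => ?_⟩
  have hn0 : 0 < n := lt_of_lt_of_le one_pos ((le_max_right _ _).trans hn)
  have hmarkov : P {ω | k ^ 2 ≤ Y n ω ^ 2} ≤ ε / 2 := by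
    have h := mul_meas_ge_le_integral_of_nonneg (μ := P) (f := fun ω => Y n ω ^ 2)
      (ae_of_all _ fun ω => sq_nonneg _) (hY n hn0).integrable_sq (k ^ 2)
    refine le_trans ?_ hδε
    rw [← ENNReal.ofReal_toReal (measure_ne_top P {ω | k ^ 2 ≤ Y n ω ^ 2})]
    refine ENNReal.ofReal_le_ofReal (le_trans ?_ hk)
    rw [le_div_iff₀ (by positivity), mul_comm]
    exact h.trans (hC n hn0)
  calc P {ω | ¬ R (q (n, ω)) (Y n ω)}
      ≤ P ({ω | ¬ ∀ y ∈ Set.Icc (-k) k, R (q (n, ω)) y} ∪ {ω | k ^ 2 ≤ Y n ω ^ 2}) := by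
        refine measure_mono fun ω hω => ?_
        by_contra hcon
        simp only [Set.mem_union, Set.mem_ofPred_eq, not_or, not_not, not_le] at hcon hω
        exact hω (hcon.1 _ (abs_le.1 (abs_lt_of_sq_lt_sq hcon.2 hk0.le).le))
    _ ≤ ε / 2 + ε / 2 := (measure_union_le _ _).trans
        (add_le_add (hN n ((le_max_left _ _).trans hn)) hmarkov)
    _ = ε := ENNReal.add_halves ε

/-- Convergence in distribution is unaffected by changes on events of vanishing probability. -/
lemma tendstoInDistribution_congr_whp [IsProbabilityMeasure P] {Ω' E : Type*}
    [MeasurableSpace Ω'] {μ' : Measure Ω'} [IsProbabilityMeasure μ'] [TopologicalSpace E]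
    [MeasurableSpace E] [OpensMeasurableSpace E] {U V : ℕ → Ω → E} {Z : Ω' → E}
    (h : TendstoInDistribution U atTop Z (fun _ => P) μ') (hV : ∀ n, AEMeasurable (V n) P)
    (hUV : ∀ᶠ z in whp P, U z.1 z.2 = V z.1 z.2) :
    TendstoInDistribution V atTop Z (fun _ => P) μ' := by
  have hU := h.forall_aemeasurable
  have hZ := h.aemeasurable_limit
  refine ⟨hV, hZ, ProbabilityMeasure.tendsto_iff_forall_integral_tendsto.2 fun f => ?_⟩
  have ht := ProbabilityMeasure.tendsto_iff_forall_integral_tendsto.1 h.tendsto f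
  simp only [ProbabilityMeasure.coe_mk] at ht ⊢
  have hmap : ∀ {W : Ω → E}, AEMeasurable W P → ∫ x, f x ∂(P.map W) = ∫ ω, f (W ω) ∂P :=
    fun hW => integral_map hW f.continuous.measurable.aestronglyMeasurable
  have hint : ∀ {W : Ω → E}, AEMeasurable W P → Integrable (fun ω => f (W ω)) P := fun hW =>
    Integrable.of_bound (f.continuous.measurable.comp_aemeasurable hW).aestronglyMeasurable ‖f‖
      (ae_of_all _ fun ω => f.norm_coe_le_norm _)
  have hdiff : Tendsto (fun n => ∫ ω, f (V n ω) ∂P - ∫ ω, f (U n ω) ∂P) atTop (𝓝 0) := by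
    rw [tendsto_zero_iff_enorm_tendsto_zero]
    have hlim : Tendsto (fun n => ENNReal.ofReal (2 * ‖f‖) * P {ω | ¬ U n ω = V n ω}) atTop
        (𝓝 0) := by
      have := ENNReal.Tendsto.const_mul (a := ENNReal.ofReal (2 * ‖f‖)) (eventually_whp.1 hUV)
        (Or.inr ENNReal.ofReal_ne_top)
      simpa using this
    refine tendsto_of_tendsto_of_tendsto_of_le_of_le tendsto_const_nhds hlim (fun _ => zero_le)
      fun n => ?_
    -- The set where `U` and `V` differ need not be measurable, so it is replaced by a measurable
    -- hull of the same measure.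
    set S := toMeasurable P {ω | ¬ U n ω = V n ω} with hS
    change ‖∫ ω, f (V n ω) ∂P - ∫ ω, f (U n ω) ∂P‖ₑ ≤ _
    rw [← integral_sub (hint (hV n)) (hint (hU n))]
    refine (enorm_integral_le_lintegral_enorm _).trans ?_
    calc ∫⁻ ω, ‖f (V n ω) - f (U n ω)‖ₑ ∂P
        ≤ ∫⁻ ω, S.indicator (fun _ => ENNReal.ofReal (2 * ‖f‖)) ω ∂P := by
          refine lintegral_mono fun ω => ?_
          by_cases hω : U n ω = V n ω
          · simp [hω]
          · rw [Set.indicator_of_mem (subset_toMeasurable P _ hω), ← ofReal_norm]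
            refine ENNReal.ofReal_le_ofReal ((norm_sub_le _ _).trans ?_)
            linarith [f.norm_coe_le_norm (V n ω), f.norm_coe_le_norm (U n ω)]
      _ = ENNReal.ofReal (2 * ‖f‖) * P {ω | ¬ U n ω = V n ω} := by
          rw [lintegral_indicator_const (measurableSet_toMeasurable _ _), measure_toMeasurable]
  have := ht.add hdiff
  rw [add_zero] at this
  refine this.congr fun n => ?_
  rw [hmap (hU n), hmap (hV n)]
  ring

end whp

/-! ### Bounds for the empirical likelihood ratio -/

/-- Second-order Taylor expansion of `log (1 + y)`: the remainder is at most `|y|³ / (1 - |y|) ≤ 2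
|y|³ ≤ 2 u y²`, which is the `4u` correction to `y² / 2`. It serves both the dual and the primal
bound. -/
lemma exp_sub_sq_le_one_add {y u : ℝ} (hy : |y| ≤ u) (hu : u ≤ 1 / 2) :
    Real.exp (y - y ^ 2 / 2 * (1 + 4 * u)) ≤ 1 + y := by
  have hy' : |y| ≤ 1 / 2 := hy.trans hu
  have h1 : 0 < 1 + y := by linarith [(abs_le.1 hy').1]
  rw [← Real.le_log_iff_exp_le h1]
  have h := Real.abs_log_sub_add_sum_range_le (x := -y) (by rw [abs_neg]; linarith) 2
  simp only [Finset.sum_range_succ, Finset.sum_range_zero, abs_neg, sub_neg_eq_add] at h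
  norm_num at h
  have h2 : |y| ^ 3 / (1 - |y|) ≤ 2 * |y| ^ 3 := by
    rw [div_le_iff₀ (by linarith)]
    nlinarith [pow_nonneg (abs_nonneg y) 3]
  have h3 : |y| ^ 3 ≤ u * y ^ 2 := by
    rw [← sq_abs y, pow_succ, mul_comm]
    exact mul_le_mul_of_nonneg_right hy (sq_nonneg _)
  linarith [(abs_le.1 h).1]

section

variable {n : ℕ} {w : Fin n → ℝ}

lemma elRatio_eq_iSup (w : Fin n → ℝ) :
    elRatio w = ⨆ p ∈ {p : Fin n → ℝ | p ∈ stdSimplex ℝ (Fin n) ∧ ∑ i, p i * w i = 0},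
      ENNReal.ofReal (∏ i, n * p i) := by
  simp only [elRatio, empLik, ENNReal.mul_iSup]
  refine iSup_congr fun p => iSup_congr fun _ => ?_
  rw [Finset.prod_mul_distrib, Finset.prod_const, Finset.card_univ, Fintype.card_fin,
    ENNReal.ofReal_mul (by positivity), ENNReal.ofReal_pow (by positivity), ENNReal.ofReal_natCast]

/-- The dual bound: each multiplier `c` gives an upper bound for the likelihood ratio. -/
lemma elRatio_le {c u : ℝ} (hu : ∀ i, |c * w i| ≤ u) (hu' : u ≤ 1 / 2) :
    elRatio w ≤ ENNReal.ofReal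
      (Real.exp (-(c * ∑ i, w i - c ^ 2 / 2 * (1 + 4 * u) * ∑ i, w i ^ 2))) := by
  rw [elRatio_eq_iSup]
  refine iSup₂_le fun p hp => ENNReal.ofReal_le_ofReal ?_
  obtain ⟨⟨hp0, hp1⟩, hpw⟩ := hp
  rw [Real.exp_neg, ← one_div, le_div_iff₀ (Real.exp_pos _)]
  have hexp : Real.exp (c * ∑ i, w i - c ^ 2 / 2 * (1 + 4 * u) * ∑ i, w i ^ 2) =
      ∏ i, Real.exp (c * w i - (c * w i) ^ 2 / 2 * (1 + 4 * u)) := by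
    rw [← Real.exp_sum, Finset.sum_sub_distrib, Finset.mul_sum, Finset.mul_sum]
    congr 2
    exact Finset.sum_congr rfl fun i _ => by ring
  rw [hexp, ← Finset.prod_mul_distrib]
  have hnp : ∀ i, 0 ≤ n * p i := fun i => mul_nonneg n.cast_nonneg (hp0 i)
  -- Weak duality: bounding each factor `n pᵢ (1 + c wᵢ)` by `exp` of itself minus one makes the
  -- exponents add up to zero, by the two constraints on `p`. The unknown weights disappear.
  calc ∏ i, n * p i * Real.exp (c * w i - (c * w i) ^ 2 / 2 * (1 + 4 * u))
      ≤ ∏ i, Real.exp (n * p i * (1 + c * w i) - 1) := by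
        refine Finset.prod_le_prod (fun i _ => mul_nonneg (hnp i) (Real.exp_pos _).le) fun i _ => ?_
        refine (mul_le_mul_of_nonneg_left (exp_sub_sq_le_one_add (hu i) hu') (hnp i)).trans ?_
        simpa using Real.add_one_le_exp (n * p i * (1 + c * w i) - 1)
    _ = Real.exp (n * ∑ i, p i + n * c * ∑ i, p i * w i - n) := by
        rw [← Real.exp_sum, Finset.sum_sub_distrib]
        simp only [Finset.sum_const, Finset.card_univ, Fintype.card_fin, nsmul_eq_mul, mul_one,
          Finset.mul_sum, ← Finset.sum_add_distrib]
        congr 2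
        exact Finset.sum_congr rfl fun i _ => by ring
    _ = 1 := by rw [hp1, hpw]; simp

/-- The primal bound: linearly tilted weights give a lower bound for the likelihood ratio. -/
lemma le_elRatio {c u : ℝ} (hn : 0 < n) (hu : ∀ i, |c * (w i - (∑ j, w j) / n)| ≤ u)
    (hu' : u ≤ 1 / 2) (hc : ∑ i, w i = c * (∑ i, w i ^ 2 - (∑ i, w i) ^ 2 / n)) :
    ENNReal.ofReal (Real.exp
      (-(c ^ 2 / 2 * (1 + 4 * u) * (∑ i, w i ^ 2 - (∑ i, w i) ^ 2 / n)))) ≤ elRatio w := by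
  have hn0 : (n : ℝ) ≠ 0 := by positivity
  set S := ∑ i, w i with hS
  have hd : ∑ i, (w i - S / n) = 0 := by
    rw [Finset.sum_sub_distrib, ← hS]
    simp only [Finset.sum_const, Finset.card_univ, Fintype.card_fin, nsmul_eq_mul]
    field_simp
    ring
  have hdw : ∑ i, (w i - S / n) * w i = ∑ i, w i ^ 2 - S ^ 2 / n := by
    have : ∀ i, (w i - S / n) * w i = w i ^ 2 - S / n * w i := fun i => by ring
    simp only [this, Finset.sum_sub_distrib, ← Finset.mul_sum, ← hS]
    ring
  have hdd : ∑ i, (w i - S / n) ^ 2 = ∑ i, w i ^ 2 - S ^ 2 / n := by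
    have : ∀ i, (w i - S / n) ^ 2 = (w i - S / n) * w i - S / n * (w i - S / n) := fun i => by ring
    simp only [this, Finset.sum_sub_distrib (fun i => (w i - S / n) * w i), ← Finset.mul_sum, hd,
      hdw]
    ring
  have hpos : ∀ i, 0 ≤ 1 - c * (w i - S / n) := fun i => by
    linarith [(abs_le.1 (hu i)).2]
  rw [elRatio_eq_iSup]
  -- Centring makes the weights sum to one, `hc` is exactly the condition that their `w`-mean
  -- vanishes, and `u ≤ 1 / 2` keeps them nonnegative.
  refine le_iSup₂_of_le (fun i => (1 - c * (w i - S / n)) / n) ⟨⟨fun i => ?_, ?_⟩, ?_⟩ ?_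
  · exact div_nonneg (hpos i) n.cast_nonneg
  · rw [← Finset.sum_div, Finset.sum_sub_distrib, ← Finset.mul_sum, hd]
    simp [hn0]
  · have : ∀ i, (1 - c * (w i - S / n)) / n * w i = (w i - c * ((w i - S / n) * w i)) / n :=
      fun i => by ring
    simp only [this, ← Finset.sum_div, Finset.sum_sub_distrib, ← Finset.mul_sum, hdw, ← hS]
    rw [← hc]
    simp
  · refine ENNReal.ofReal_le_ofReal ?_
    have hexp : Real.exp (-(c ^ 2 / 2 * (1 + 4 * u) * (∑ i, w i ^ 2 - S ^ 2 / n))) =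
        ∏ i, Real.exp (-(c * (w i - S / n)) - (-(c * (w i - S / n))) ^ 2 / 2 * (1 + 4 * u)) := by
      rw [← Real.exp_sum, Finset.sum_sub_distrib, Finset.sum_neg_distrib, ← Finset.mul_sum, hd,
        ← hdd, Finset.mul_sum]
      simp only [mul_zero, neg_zero, zero_sub]
      congr 2
      exact Finset.sum_congr rfl fun i _ => by ring
    rw [hexp]
    refine Finset.prod_le_prod (fun i _ => (Real.exp_pos _).le) fun i _ => ?_
    rw [mul_div_cancel₀ _ hn0]
    exact (exp_sub_sq_le_one_add (by rw [abs_neg]; exact hu i) hu').trans_eq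
      (sub_eq_add_neg _ _).symm

lemma neg_two_mul_log_ofReal_exp (a : ℝ) :
    -(2 * ENNReal.log (ENNReal.ofReal (Real.exp (-a)))) = ((2 * a : ℝ) : EReal) := by
  rw [ENNReal.log_ofReal_of_pos (Real.exp_pos _), Real.log_exp]
  rw [show (2 : EReal) = ((2 : ℝ) : EReal) from rfl, ← EReal.coe_mul, ← EReal.coe_neg]
  congr 1
  ring

/-- Two-sided bounds for the empirical log-likelihood ratio, in terms of
`B = n^(-1/2) ∑ wᵢ`, `A = n⁻¹ ∑ wᵢ²` and `m = n^(-1/2) max |wᵢ|`. -/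
lemma exists_logRatio_eq {A B m D : ℝ} (hn : 0 < n) (hA : A = (∑ i, w i ^ 2) / n)
    (hB : B = (∑ i, w i) / √n) (hm : m = ‖w‖ / √n) (hD : D = A - B ^ 2 / n) (hD0 : 0 < D)
    (hsmall : |B| * m / D ≤ 1 / 4) :
    ∃ l : ℝ, -(2 * ENNReal.log (elRatio w)) = (l : EReal) ∧
      B ^ 2 / A * (1 - 4 * (|B| * m / A)) ≤ l ∧ l ≤ B ^ 2 / D * (1 + 8 * (|B| * m / D)) := by
  have hs : 0 < √(n : ℝ) := Real.sqrt_pos.2 (by exact_mod_cast hn)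
  have hss : √(n : ℝ) ^ 2 = n := Real.sq_sqrt n.cast_nonneg
  have hn0 : (n : ℝ) ≠ 0 := by positivity
  have hm0 : 0 ≤ m := hm ▸ by positivity
  have hDA : D ≤ A := by rw [hD]; linarith [show 0 ≤ B ^ 2 / n by positivity]
  have hA0 : 0 < A := hD0.trans_le hDA
  have hS1 : ∑ i, w i = B * √n := by rw [hB]; field_simp
  have hS2 : ∑ i, w i ^ 2 = A * n := by rw [hA]; field_simp
  have hw : ‖w‖ = m * √n := by rw [hm]; field_simp
  have hwi : ∀ i, |w i| ≤ m * √n := fun i => hw ▸ norm_le_pi_norm w i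
  have hmean : |(∑ j, w j) / n| ≤ m * √n := by
    rw [abs_div, Nat.abs_cast, div_le_iff₀ (by positivity)]
    refine (Finset.abs_sum_le_sum_abs _ _).trans ((Finset.sum_le_sum fun i _ => hwi i).trans ?_)
    simp [mul_comm]
  have hsmall' : |B| * m / A ≤ 1 / 4 :=
    (div_le_div_of_nonneg_left (by positivity) hD0 hDA).trans hsmall
  -- This multiplier is `∑ wᵢ / ∑ wᵢ²`, the maximizer of the quadratic `c ∑ wᵢ - c² / 2 ∑ wᵢ²`.
  have hup := elRatio_le (w := w) (c := B / (√n * A)) (u := |B| * m / A) (fun i => by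
    rw [abs_mul, abs_div, abs_of_pos (mul_pos hs hA0)]
    calc |B| / (√n * A) * |w i| ≤ |B| / (√n * A) * (m * √n) := by gcongr; exact hwi i
      _ = |B| * m / A := by field_simp) (by linarith)
  have hdiff : ∑ i, w i ^ 2 - (∑ i, w i) ^ 2 / n = D * n := by
    rw [hS1, hS2, mul_pow, hss, hD]
    field_simp
  -- Feasibility of the tilted weights forces this `c`, since `D` is the sample variance. Centred
  -- values are bounded only by twice the maximum, so `4u` becomes the factor `8`.
  have hlo := le_elRatio (w := w) (c := B / (√n * D)) (u := 2 * (|B| * m / D)) hn (fun i => by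
    rw [abs_mul, abs_div, abs_of_pos (mul_pos hs hD0)]
    calc |B| / (√n * D) * |w i - (∑ j, w j) / n|
        ≤ |B| / (√n * D) * (m * √n + m * √n) := by
          gcongr
          exact (abs_sub _ _).trans (add_le_add (hwi i) hmean)
      _ = 2 * (|B| * m / D) := by field_simp; ring) (by linarith) (by
        
        rw [hdiff, hS1, show B / (√n * D) * (D * n) = B * (n / √n) by field_simp, Real.div_sqrt])
  rw [hdiff] at hlo
  rw [hS1, hS2] at hup
  have hmono : ∀ {a b : ℝ≥0∞}, a ≤ b → -(2 * ENNReal.log b) ≤ -(2 * ENNReal.log a) := fun h =>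
    EReal.neg_le_neg_iff.2 (mul_le_mul_of_nonneg_left (ENNReal.log_monotone h) (by norm_num))
  have h1 := hmono hup
  have h2 := hmono hlo
  rw [neg_two_mul_log_ofReal_exp] at h1 h2
  have e1 : 2 * (B / (√n * A) * (B * √n) -
      (B / (√n * A)) ^ 2 / 2 * (1 + 4 * (|B| * m / A)) * (A * n)) =
      B ^ 2 / A * (1 - 4 * (|B| * m / A)) := by
    rw [div_pow, mul_pow, hss]
    field_simp
    ring
  have e2 : 2 * ((B / (√n * D)) ^ 2 / 2 * (1 + 4 * (2 * (|B| * m / D))) * (D * n)) =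
      B ^ 2 / D * (1 + 8 * (|B| * m / D)) := by
    rw [div_pow, mul_pow, hss]
    field_simp
    ring
  rw [e1] at h1
  rw [e2] at h2
  lift -(2 * ENNReal.log (elRatio w)) to ℝ using
    ⟨ne_top_of_le_ne_top (EReal.coe_ne_top _) h2, ne_bot_of_le_ne_bot (EReal.coe_ne_bot _) h1⟩
    with l
  exact ⟨l, rfl, EReal.coe_le_coe_iff.1 h1, EReal.coe_le_coe_iff.1 h2⟩

end

/-! ### The sample quantile -/

section sample

variable {n : ℕ} {x : Fin n → ℝ} {t : ℝ}

lemma empCdf_eq_sum (x : Fin n → ℝ) (y : ℝ) :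
    empCdf x y = (∑ i, (Set.Iic y).indicator 1 (x i)) / n := by
  classical
  simp [empCdf, Set.indicator_apply, Finset.sum_boole]

lemma empCdf_mono (x : Fin n → ℝ) : Monotone (empCdf x) := by
  intro a b hab
  simp only [empCdf_eq_sum]
  refine div_le_div_of_nonneg_right (Finset.sum_le_sum fun i _ => ?_) n.cast_nonneg
  exact Set.indicator_le_indicator_of_subset (f := (1 : ℝ → ℝ)) (Set.Iic_subset_Iic.2 hab)
    (fun _ => zero_le_one' ℝ) _

/-- The empirical distribution function is unchanged on moving left to the nearest observation, and
`0 < t` guarantees that there is one. A finite union of closed rays is closed and bounded below, so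
the infimum defining the sample quantile is attained. -/
lemma setOf_le_empCdf_eq (ht : 0 < t) (x : Fin n → ℝ) :
    {y | t ≤ empCdf x y} = ⋃ i ∈ {i | t ≤ empCdf x (x i)}, Set.Ici (x i) := by
  classical
  ext y
  simp only [Set.mem_iUnion, Set.mem_Ici, exists_prop]
  constructor
  · intro hy
    have hne : (Finset.univ.filter (fun i => x i ≤ y)).Nonempty := by
      rw [← Finset.card_pos, Nat.pos_iff_ne_zero]
      intro h0
      have h0' : empCdf x y = 0 := by
        rw [Finset.card_eq_zero, Finset.filter_eq_empty_iff] at h0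
        have : ∀ i, ¬ x i ≤ y := fun i => h0 (Finset.mem_univ i)
        simp [empCdf_eq_sum, this]
      exact absurd (h0' ▸ hy : t ≤ 0) (not_le.2 ht)
    obtain ⟨i, hi, hmax⟩ := Finset.exists_max_image _ x hne
    simp only [Finset.mem_filter, Finset.mem_univ, true_and] at hi hmax
    refine ⟨i, ?_, hi⟩
    have : empCdf x (x i) = empCdf x y := by
      simp only [empCdf_eq_sum]
      congr 1
      refine Finset.sum_congr rfl fun j _ => ?_
      have : x j ≤ x i ↔ x j ≤ y := ⟨fun h => h.trans hi, hmax j⟩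
      simp [Set.indicator_apply, this]
    exact Set.mem_ofPred_eq ▸ this.symm ▸ hy
  · rintro ⟨i, hi, hiy⟩
    exact le_trans (show t ≤ _ from hi) (empCdf_mono x hiy)

lemma bddBelow_le_empCdf (ht : 0 < t) (x : Fin n → ℝ) : BddBelow {y | t ≤ empCdf x y} := by
  rw [setOf_le_empCdf_eq ht]
  exact (Set.toFinite _).bddBelow_biUnion.2 fun i _ => bddBelow_Ici

lemma exists_empCdf_eq_one (hn : 0 < n) (x : Fin n → ℝ) : ∃ y, empCdf x y = 1 := by
  obtain ⟨y, hy⟩ := (Set.finite_range x).bddAbove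
  refine ⟨y, ?_⟩
  have : ∀ i, x i ≤ y := fun i => hy ⟨i, rfl⟩
  have hn' : (n : ℝ) ≠ 0 := by positivity
  simp [empCdf_eq_sum, this, hn']

lemma le_empCdf_sampleQuantile (hn : 0 < n) (ht : 0 < t) (ht1 : t ≤ 1) (x : Fin n → ℝ) :
    t ≤ empCdf x (sampleQuantile x t) := by
  have hcl : IsClosed {y | t ≤ empCdf x y} := by
    rw [setOf_le_empCdf_eq ht]
    exact (Set.toFinite _).isClosed_biUnion fun i _ => isClosed_Ici
  obtain ⟨y, hy⟩ := exists_empCdf_eq_one hn x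
  exact hcl.csInf_mem ⟨y, ht1.trans_eq hy.symm⟩ (bddBelow_le_empCdf ht x)

/-- Turns events about the random quantile into events about the empirical distribution function at
a fixed point; measurability and consistency of the quantile both follow from it. -/
lemma sampleQuantile_le_iff (hn : 0 < n) (ht : 0 < t) (ht1 : t ≤ 1) {y : ℝ} :
    sampleQuantile x t ≤ y ↔ t ≤ empCdf x y :=
  ⟨fun h => (le_empCdf_sampleQuantile hn ht ht1 x).trans (empCdf_mono x h),
    fun h => csInf_le (bddBelow_le_empCdf ht x) h⟩

/-- If no two observations coincide with the sample quantile, the empirical distribution function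
overshoots `t` by at most `1 / n` there. -/
lemma empCdf_sampleQuantile_le (hn : 0 < n) (ht : 0 < t) (ht1 : t ≤ 1)
    (h : ∀ i j, x i = sampleQuantile x t → x j = sampleQuantile x t → i = j) :
    empCdf x (sampleQuantile x t) ≤ t + 1 / n := by
  classical
  set q := sampleQuantile x t with hq
  have hn' : (0 : ℝ) < n := by positivity
  have hlt : ∀ y < q, empCdf x y < t := fun y hy => by
    by_contra hcon
    exact absurd ((sampleQuantile_le_iff hn ht ht1).2 (not_lt.1 hcon)) (not_le.2 hy)
  -- The observations below `q` are those up to the largest such observation, where the empirical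
  -- distribution function is still below `t`. At most one further observation sits at `q` itself,
  -- whence the `1 / n`.
  have hstrict : (∑ i, (Set.Iio q).indicator (1 : ℝ → ℝ) (x i)) ≤ t * n := by
    rcases (Finset.univ.filter (fun i => x i < q)).eq_empty_or_nonempty with h0 | hne
    · have : ∀ i, (Set.Iio q).indicator (1 : ℝ → ℝ) (x i) = 0 := fun i => by
        refine Set.indicator_of_notMem (fun hi => ?_) _
        exact (Finset.eq_empty_iff_forall_notMem.1 h0 i) (by simpa using hi)
      simp only [this, Finset.sum_const_zero]
      positivity
    · obtain ⟨k, hk, hmax⟩ := Finset.exists_max_image _ x hne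
      simp only [Finset.mem_filter, Finset.mem_univ, true_and] at hk hmax
      have hk' := hlt _ hk
      rw [empCdf_eq_sum, div_lt_iff₀ hn'] at hk'
      refine le_trans (Finset.sum_le_sum fun i _ => ?_) hk'.le
      by_cases hi : x i < q
      · simp [hi, hmax i hi]
      · rw [Set.indicator_of_notMem (by simpa using hi)]
        exact Set.indicator_nonneg (fun _ _ => zero_le_one' ℝ) _
  have heq : (∑ i, ({q} : Set ℝ).indicator (1 : ℝ → ℝ) (x i)) ≤ 1 := by
    have : (∑ i, ({q} : Set ℝ).indicator (1 : ℝ → ℝ) (x i)) =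
        ((Finset.univ.filter (fun i => x i = q)).card : ℝ) := by
      simp [Set.indicator_apply, Finset.sum_boole]
    rw [this]
    exact_mod_cast Finset.card_le_one.2 fun i hi j hj =>
      h i j (by simpa using hi) (by simpa using hj)
  rw [empCdf_eq_sum, div_le_iff₀ hn', add_mul, one_div_mul_cancel hn'.ne']
  refine le_trans (le_of_eq ?_) (add_le_add hstrict heq)
  rw [← Finset.sum_add_distrib]
  refine Finset.sum_congr rfl fun i _ => ?_
  rcases lt_trichotomy (x i) q with h1 | h1 | h1
  · simp [h1, h1.le, h1.ne]
  · simp [h1]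
  · simp [h1.not_ge, h1.not_gt, h1.ne']

end sample

/-! ### Measurability -/

section measurability

variable {n : ℕ}

lemma measurable_empCdf (y : ℝ) : Measurable fun x : Fin n → ℝ => empCdf x y := by
  simp only [empCdf_eq_sum]
  refine (Finset.measurable_fun_sum _ fun i _ => ?_).div_const _
  exact (measurable_one.indicator measurableSet_Iic).comp (measurable_pi_apply i)

lemma measurable_sampleQuantile {t : ℝ} (ht : 0 < t) (ht1 : t ≤ 1) :
    Measurable fun x : Fin n → ℝ => sampleQuantile x t := by
  rcases Nat.eq_zero_or_pos n with rfl | hn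
  · exact Subsingleton.measurable
  · refine measurable_of_Iic fun y => ?_
    have : (fun x : Fin n → ℝ => sampleQuantile x t) ⁻¹' Set.Iic y =
        (fun x : Fin n → ℝ => empCdf x y) ⁻¹' Set.Ici t := by
      ext x
      exact sampleQuantile_le_iff hn ht ht1
    rw [this]
    exact measurable_empCdf y measurableSet_Ici

lemma measurable_wHat {t : ℝ} (ht : 0 < t) (ht1 : t ≤ 1) (θ : ℝ) :
    Measurable fun x : Fin n → ℝ => wHat x t θ := by
  refine measurable_pi_lambda _ fun i => ?_
  simp only [wHat, Set.indicator_apply, Set.mem_Iic]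
  exact (Measurable.ite (measurableSet_le (measurable_pi_apply i)
    (measurable_sampleQuantile ht ht1)) (measurable_pi_apply i) measurable_const).sub_const _

/-- The supremum is uncountable and its domain depends on `w`, but it is attained on a compact set.
Superlevel sets are therefore projections of closed sets along the compact simplex, hence closed. -/
lemma measurable_empLik : Measurable (empLik : (Fin n → ℝ) → ℝ≥0∞) := by
  refine measurable_of_Ici fun c => ?_
  -- Level zero is separate: it also contains the `w` with no feasible `p`, which the projection
  -- below misses.
  rcases eq_or_ne c 0 with rfl | hc
  · simp
  have hcont : Continuous fun p : Fin n → ℝ => ENNReal.ofReal (∏ i, p i) :=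
    ENNReal.continuous_ofReal.comp (by fun_prop)
  have hset : empLik ⁻¹' Set.Ici c = Prod.snd '' {z : stdSimplex ℝ (Fin n) × (Fin n → ℝ) |
      ∑ i, z.1.1 i * z.2 i = 0 ∧ c ≤ ENNReal.ofReal (∏ i, z.1.1 i)} := by
    ext w
    simp only [Set.mem_preimage, Set.mem_Ici, Set.mem_image, Prod.exists, exists_eq_right]
    constructor
    · intro hw
      set K := {p : Fin n → ℝ | p ∈ stdSimplex ℝ (Fin n) ∧ ∑ i, p i * w i = 0} with hK
      have hKc : IsCompact K := (isCompact_stdSimplex ℝ (Fin n)).inter_right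
        (isClosed_eq (by fun_prop) continuous_const)
      have hKne : K.Nonempty := by
        by_contra hne
        rw [Set.not_nonempty_iff_eq_empty] at hne
        have : empLik w = 0 := by simp [empLik, ← hK, hne]
        exact hc (le_zero_iff.1 (this ▸ hw))
      obtain ⟨p, hp, hmax⟩ := hKc.exists_isMaxOn hKne hcont.continuousOn
      exact ⟨⟨p, hp.1⟩, hp.2, hw.trans (iSup₂_le fun p' hp' => hmax hp')⟩
    · rintro ⟨p, hp, hpc⟩
      exact hpc.trans (le_iSup₂_of_le p.1 ⟨p.2, hp⟩ le_rfl)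
  rw [hset]
  have : CompactSpace (stdSimplex ℝ (Fin n)) :=
    isCompact_iff_compactSpace.1 (isCompact_stdSimplex ℝ (Fin n))
  refine (isClosedMap_snd_of_compactSpace _ ?_).measurableSet
  have hcoord : ∀ i, Continuous fun z : stdSimplex ℝ (Fin n) × (Fin n → ℝ) => z.1.1 i := fun i =>
    (continuous_apply i).comp (continuous_subtype_val.comp continuous_fst)
  refine IsClosed.inter (isClosed_eq (continuous_finsetSum _ fun i _ => (hcoord i).mul
    ((continuous_apply i).comp continuous_snd)) continuous_const)
    (isClosed_le continuous_const (hcont.comp (continuous_subtype_val.comp continuous_fst)))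

lemma measurable_transformedLogELRatio {t : ℝ} (ht : 0 < t) (ht1 : t ≤ 1) (θ : ℝ) :
    Measurable fun x : Fin n → ℝ => transformedLogELRatio x t θ := by
  have hl : Measurable fun x : Fin n → ℝ => logELRatio x t θ := by
    unfold logELRatio elRatio
    have := (measurable_empLik (n := n)).comp (measurable_wHat ht ht1 θ)
    exact (measurable_const.mul (ENNReal.measurable_log.comp (this.const_mul _))).neg
  unfold transformedLogELRatio
  refine hl.mul (Measurable.max ?_ measurable_const)
  simp only [sub_eq_add_neg, div_eq_mul_inv]
  exact measurable_const.add (hl.mul measurable_const).neg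

end measurability

/-! ### The population quantile -/

section population

variable {ν : Measure ℝ} {t : ℝ}

lemma bddBelow_le_cdf (ht : 0 < t) : BddBelow {x | t ≤ cdf ν x} := by
  obtain ⟨b, hb⟩ := ((tendsto_cdf_atBot ν).eventually (gt_mem_nhds ht)).exists
  exact ⟨b, fun x hx => le_of_not_gt fun hlt =>
    absurd ((monotone_cdf ν hlt.le).trans_lt hb) (not_lt.2 hx)⟩

lemma quantile_le (ht : 0 < t) {x : ℝ} (hx : t ≤ cdf ν x) : quantile ν t ≤ x :=
  csInf_le (bddBelow_le_cdf ht) hx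

lemma cdf_lt_of_lt_quantile (ht : 0 < t) {x : ℝ} (hx : x < quantile ν t) : cdf ν x < t :=
  not_le.1 fun h => absurd (quantile_le ht h) (not_le.2 hx)

/-- The value is squeezed between the left limit, at most `t` by definition of the quantile, and the
right limit, at least `t` by `huniq`. -/
lemma cdf_quantile (ht : 0 < t) (hcont : ContinuousAt (fun y => cdf ν y) (quantile ν t))
    (huniq : ∀ x, quantile ν t < x → t < cdf ν x) : cdf ν (quantile ν t) = t := by
  refine le_antisymm ?_ ?_
  · refine le_of_tendsto (hcont.tendsto.mono_left (nhdsWithin_le_nhds (s := Set.Iio (quantile ν t)))) ?_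
    filter_upwards [self_mem_nhdsWithin] with x hx using (cdf_lt_of_lt_quantile ht hx).le
  · refine ge_of_tendsto (hcont.tendsto.mono_left (nhdsWithin_le_nhds (s := Set.Ioi (quantile ν t)))) ?_
    filter_upwards [self_mem_nhdsWithin] with x hx using (huniq x hx).le

lemma memLp_id_of_sq (hsq : Integrable (fun x : ℝ => x ^ 2) ν) :
    MemLp (fun x : ℝ => x) 2 ν :=
  (memLp_two_iff_integrable_sq aestronglyMeasurable_id).2 hsq

lemma memLp_indicator_id (hsq : Integrable (fun x : ℝ => x ^ 2) ν) :
    MemLp ((Set.Iic (quantile ν t)).indicator (fun x => x)) 2 ν :=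
  (memLp_id_of_sq hsq).indicator measurableSet_Iic

variable [IsProbabilityMeasure ν]

lemma measure_singleton_of_continuousAt_cdf {x : ℝ} (h : ContinuousAt (fun y => cdf ν y) x) :
    ν {x} = 0 := by
  rw [← measure_cdf ν, StieltjesFunction.measure_singleton, ENNReal.ofReal_eq_zero, sub_nonpos]
  refine le_of_eq ?_
  exact h.continuousWithinAt.leftLim_eq.symm

lemma measureReal_Ioi_quantile_pos (ht1 : t < 1) (hq : cdf ν (quantile ν t) = t) :
    0 < ν.real (Set.Ioi (quantile ν t)) := by
  rw [← Set.compl_Iic, probReal_compl_eq_one_sub measurableSet_Iic, ← cdf_eq_real, hq]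
  linarith

/-- A square integrable function vanishing beyond the quantile is degenerate only if it vanishes. -/
lemma ae_eq_zero_of_variance_indicator (ht1 : t < 1) (hq : cdf ν (quantile ν t) = t) {f : ℝ → ℝ}
    (hf : MemLp ((Set.Iic (quantile ν t)).indicator f) 2 ν)
    (h0 : variance ((Set.Iic (quantile ν t)).indicator f) ν = 0) :
    ∀ᵐ x ∂ν, x ≤ quantile ν t → f x = 0 := by
  have hae := ae_eq_integral_of_variance_eq_zero hf h0
  set c := ∫ x, (Set.Iic (quantile ν t)).indicator f x ∂ν
  have hc : c = 0 := by
    -- The indicator makes the function vanish beyond the quantile, an event of probability `1 - t >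
    -- 0`, so its almost sure constant value can only be zero.
    by_contra hc
    have : ν (Set.Ioi (quantile ν t)) = 0 := by
      refine measure_mono_null (fun x hx => ?_) hae
      intro hx'
      have hx' : (Set.Iic (quantile ν t)).indicator f x = c := hx'
      rw [Set.indicator_of_notMem (by simpa using hx)] at hx'
      exact hc hx'.symm
    have hpos := measureReal_Ioi_quantile_pos ht1 hq
    rw [measureReal_def, this] at hpos
    simp at hpos
  filter_upwards [hae] with x hx hxq
  rwa [Set.indicator_of_mem (by exact hxq), hc] at hx

variable (hsq : Integrable (fun x : ℝ => x ^ 2) ν)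

include hsq

lemma memLp_indicator_sub (c : ℝ) :
    MemLp ((Set.Iic (quantile ν t)).indicator (fun x => x - c)) 2 ν :=
  ((memLp_id_of_sq hsq).sub (memLp_const c)).indicator measurableSet_Iic

/-- Degeneracy would put the whole mass `t > 0` of `(-∞, ψ]` at `ψ`, where continuity excludes an
atom. -/
lemma sigmaVSq_pos (ht : 0 < t) (ht1 : t < 1)
    (hcont : ContinuousAt (fun y => cdf ν y) (quantile ν t))
    (huniq : ∀ x, quantile ν t < x → t < cdf ν x) : 0 < sigmaVSq ν t := by
  have hq := cdf_quantile ht hcont huniq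
  refine lt_of_le_of_ne (variance_nonneg _ _) fun h0 => ?_
  have hae := ae_eq_zero_of_variance_indicator ht1 hq (memLp_indicator_sub hsq _) h0.symm
  have hsub : ν (Set.Iic (quantile ν t)) ≤ ν {quantile ν t} := by
    refine measure_mono_ae ?_
    filter_upwards [hae] with x hx hxq using sub_eq_zero.1 (hx hxq)
  rw [measure_singleton_of_continuousAt_cdf hcont, ← ofReal_cdf, hq] at hsub
  exact absurd hsub (by simpa using ht)

/-- Degeneracy would concentrate the mass `t` of `(-∞, ψ]` at `0`. Then `0 ≤ ψ`, while `F(0) ≥ t`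
gives `ψ ≤ 0`, so `ψ = 0` would be an atom. -/
lemma sigmaPSq_pos (ht : 0 < t) (ht1 : t < 1)
    (hcont : ContinuousAt (fun y => cdf ν y) (quantile ν t))
    (huniq : ∀ x, quantile ν t < x → t < cdf ν x) : 0 < sigmaPSq ν t := by
  have hq := cdf_quantile ht hcont huniq
  refine lt_of_le_of_ne (variance_nonneg _ _) fun h0 => ?_
  have hae := ae_eq_zero_of_variance_indicator ht1 hq (memLp_indicator_id hsq) h0.symm
  have hsub : ν (Set.Iic (quantile ν t)) ≤ ν ({0} ∩ Set.Iic (quantile ν t)) := by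
    refine measure_mono_ae ?_
    filter_upwards [hae] with x hx hxq using ⟨hx hxq, hxq⟩
  rw [← ofReal_cdf, hq] at hsub
  have hpos : 0 < ν ({0} ∩ Set.Iic (quantile ν t)) :=
    (ENNReal.ofReal_pos.2 ht).trans_le hsub
  obtain ⟨x, hx0, hxq⟩ := nonempty_of_measure_ne_zero hpos.ne'
  have hx0 : x = 0 := hx0
  subst hx0
  have hle : quantile ν t ≤ 0 := by
    refine quantile_le ht ((ENNReal.ofReal_le_ofReal_iff (cdf_nonneg ν 0)).1 ?_)
    rw [ofReal_cdf]
    exact hsub.trans (measure_mono fun x hx => (show x = 0 from hx.1).le)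
  have hzero : ν ({0} ∩ Set.Iic (quantile ν t)) = 0 :=
    measure_mono_null Set.inter_subset_left
      (le_antisymm hle hxq ▸ measure_singleton_of_continuousAt_cdf hcont)
  exact hpos.ne' hzero

/-- The mean of `(X - ψ) 1(X ≤ ψ)`. -/
lemma integral_indicator_sub_quantile (hq : cdf ν (quantile ν t) = t) :
    ∫ x, (Set.Iic (quantile ν t)).indicator (fun x => x - quantile ν t) x ∂ν =
      lorenz ν t - quantile ν t * t := by
  have h1 := (memLp_indicator_id (t := t) hsq).integrable one_le_two
  have h2 : Integrable ((Set.Iic (quantile ν t)).indicator (fun _ => quantile ν t)) ν :=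
    (integrable_const _).indicator measurableSet_Iic
  have : (Set.Iic (quantile ν t)).indicator (fun x => x - quantile ν t) =
      fun x => (Set.Iic (quantile ν t)).indicator (fun x => x) x -
        (Set.Iic (quantile ν t)).indicator (fun _ => quantile ν t) x := by
    ext x
    by_cases hx : x ≤ quantile ν t <;> simp [hx]
  rw [this, integral_sub h1 h2, integral_indicator_const _ measurableSet_Iic, ← cdf_eq_real, hq,
    smul_eq_mul, mul_comm]
  rfl

end population

/-! ### The effect of estimating the quantile -/

section perturbation

variable {n : ℕ} (x : Fin n → ℝ)

lemma sum_indicator_Iic_eq (hn : 0 < n) (y : ℝ) :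
    (∑ i, (Set.Iic y).indicator (1 : ℝ → ℝ) (x i)) = n * empCdf x y := by
  rw [empCdf_eq_sum]
  field_simp

lemma sum_abs_indicator_sub (hn : 0 < n) (a b : ℝ) :
    ∑ i, |(Set.Iic a).indicator (1 : ℝ → ℝ) (x i) - (Set.Iic b).indicator 1 (x i)| =
      n * |empCdf x a - empCdf x b| := by
  wlog hab : b ≤ a generalizing a b
  · rw [abs_sub_comm (empCdf x a), ← this b a (le_of_not_ge hab)]
    exact Finset.sum_congr rfl fun i _ => abs_sub_comm _ _
  have hle : ∀ i, (Set.Iic b).indicator (1 : ℝ → ℝ) (x i) ≤ (Set.Iic a).indicator 1 (x i) :=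
    fun i => Set.indicator_le_indicator_of_subset (f := (1 : ℝ → ℝ)) (Set.Iic_subset_Iic.2 hab)
      (fun _ => zero_le_one' ℝ) _
  rw [abs_of_nonneg (sub_nonneg.2 (empCdf_mono x hab))]
  simp only [abs_of_nonneg (sub_nonneg.2 (hle _)), Finset.sum_sub_distrib,
    sum_indicator_Iic_eq x hn]
  ring

/-- The indicators differ only for `y` between `a` and `b`, where `|y - b| ≤ |a - b|`. -/
lemma abs_sub_mul_indicator_sub_le (a b y : ℝ) :
    |(y - b) * ((Set.Iic a).indicator (1 : ℝ → ℝ) y - (Set.Iic b).indicator 1 y)| ≤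
      |a - b| * |(Set.Iic a).indicator (1 : ℝ → ℝ) y - (Set.Iic b).indicator 1 y| := by
  rw [abs_mul]
  by_cases ha : y ≤ a <;> by_cases hb : y ≤ b
  · simp [ha, hb]
  · simp only [Set.mem_Iic, ha, hb, Set.indicator_of_mem, Set.indicator_of_notMem,
      not_false_eq_true, Pi.one_apply, sub_zero, abs_one, mul_one]
    push Not at hb
    rw [abs_of_pos (sub_pos.2 hb), abs_of_nonneg (by linarith)]
    linarith
  · simp only [Set.mem_Iic, ha, hb, Set.indicator_of_mem, Set.indicator_of_notMem,
      not_false_eq_true, Pi.one_apply, zero_sub, abs_neg, abs_one, mul_one]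
    push Not at ha
    rw [abs_of_nonpos (sub_nonpos.2 hb), abs_of_nonpos (by linarith)]
    linarith
  · simp [ha, hb]

/-- Linearization of the estimating equation around the true quantile `b`. -/
lemma abs_sum_wHat_sub_le (hn : 0 < n) (t θ b : ℝ) :
    |∑ i, wHat x t θ i -
        ∑ i, ((Set.Iic b).indicator (fun y => y - b) (x i) - (θ - b * t))| ≤
      n * (|sampleQuantile x t - b| *
        |empCdf x (sampleQuantile x t) - empCdf x b| +
        |b| * |empCdf x (sampleQuantile x t) - t|) := by
  set q := sampleQuantile x t with hq
  -- Adding and subtracting `b · 1(xᵢ ≤ q)` leaves a part that is small where the indicators differ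
  -- and a part that sums to `n b (F̂(q) - t)`. This is why `X` is replaced by `X - ψ` in the limit.
  have hterm : ∀ i, wHat x t θ i - ((Set.Iic b).indicator (fun y => y - b) (x i) - (θ - b * t)) =
      (x i - b) * ((Set.Iic q).indicator (1 : ℝ → ℝ) (x i) - (Set.Iic b).indicator 1 (x i)) +
        b * ((Set.Iic q).indicator (1 : ℝ → ℝ) (x i) - t) := fun i => by
    simp only [wHat, ← hq]
    by_cases h1 : x i ≤ q <;> by_cases h2 : x i ≤ b <;> simp [h1, h2] <;> ring
  rw [← Finset.sum_sub_distrib, Finset.sum_congr rfl fun i _ => hterm i, Finset.sum_add_distrib,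
    mul_add]
  refine (abs_add_le _ _).trans (add_le_add ?_ (le_of_eq ?_))
  · refine (Finset.abs_sum_le_sum_abs _ _).trans
      ((Finset.sum_le_sum fun i _ => abs_sub_mul_indicator_sub_le q b (x i)).trans_eq ?_)
    rw [← Finset.mul_sum, sum_abs_indicator_sub x hn]
    ring
  · rw [← Finset.mul_sum, Finset.sum_sub_distrib, sum_indicator_Iic_eq x hn]
    simp only [Finset.sum_const, Finset.card_univ, Fintype.card_fin, nsmul_eq_mul]
    rw [← mul_sub, abs_mul, abs_mul, Nat.abs_cast]
    ring

lemma abs_sum_wHat_sq_sub_le (hn : 0 < n) (t θ b : ℝ) (hb : |sampleQuantile x t - b| ≤ 1) :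
    |(∑ i, wHat x t θ i ^ 2) / n - (∑ i, ((Set.Iic b).indicator (fun y => y) (x i) - θ) ^ 2) / n| ≤
      (|b| + 1) * (|b| + 1 + 2 * |θ|) * |empCdf x (sampleQuantile x t) - empCdf x b| := by
  set q := sampleQuantile x t with hq
  have hterm : ∀ i, |wHat x t θ i ^ 2 - ((Set.Iic b).indicator (fun y => y) (x i) - θ) ^ 2| ≤
      (|b| + 1) * (|b| + 1 + 2 * |θ|) *
        |(Set.Iic q).indicator (1 : ℝ → ℝ) (x i) - (Set.Iic b).indicator 1 (x i)| := fun i => by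
    -- Where the indicators differ, the two squares differ by `±((x - θ)² - θ²) = ±x (x - 2θ)`, and
    -- `x` lies within distance one of `b`.
    have key : (x i ≤ q ∧ ¬ x i ≤ b ∨ ¬ x i ≤ q ∧ x i ≤ b) →
        |x i * (x i - 2 * θ)| ≤ (|b| + 1) * (|b| + 1 + 2 * |θ|) := fun h => by
      have hx : |x i| ≤ |b| + 1 := by
        have : |x i - b| ≤ 1 := by
          rcases h with h | h <;> simp only [not_le] at h <;> rw [abs_le] at hb ⊢ <;>
            constructor <;> linarith
        calc |x i| = |b + (x i - b)| := by ring_nf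
          _ ≤ |b| + 1 := (abs_add_le _ _).trans (by linarith)
      rw [abs_mul]
      refine mul_le_mul hx ((abs_sub _ _).trans ?_) (abs_nonneg _) (by positivity)
      rw [abs_mul, abs_two]
      linarith
    simp only [wHat, ← hq]
    by_cases h1 : x i ≤ q <;> by_cases h2 : x i ≤ b
    · simp [h1, h2]
    · have := key (Or.inl ⟨h1, h2⟩)
      simp only [Set.mem_Iic, h1, h2, Set.indicator_of_mem, Set.indicator_of_notMem,
        not_false_eq_true, Pi.one_apply, sub_zero, abs_one, mul_one, zero_sub]
      convert this using 2
      ring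
    · have := key (Or.inr ⟨h1, h2⟩)
      simp only [Set.mem_Iic, h1, h2, Set.indicator_of_mem, Set.indicator_of_notMem,
        not_false_eq_true, Pi.one_apply, zero_sub, abs_neg, abs_one, mul_one]
      rw [abs_sub_comm]
      convert this using 2
      ring
    · simp [h1, h2]
  have hn' : (0 : ℝ) < n := by positivity
  rw [← sub_div, ← Finset.sum_sub_distrib, abs_div, Nat.abs_cast, div_le_iff₀ hn']
  refine (Finset.abs_sum_le_sum_abs _ _).trans ((Finset.sum_le_sum fun i _ => hterm i).trans_eq ?_)
  rw [← Finset.mul_sum, sum_abs_indicator_sub x hn]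
  ring

lemma wHat_sq_le (t θ : ℝ) (i : Fin n) : wHat x t θ i ^ 2 ≤ 2 * x i ^ 2 + 2 * θ ^ 2 := by
  unfold wHat
  by_cases h : x i ≤ sampleQuantile x t
  · simp only [Set.mem_Iic, h, Set.indicator_of_mem]
    nlinarith [sq_nonneg (x i + θ)]
  · simp only [Set.mem_Iic, h, not_false_eq_true, Set.indicator_of_notMem]
    nlinarith [sq_nonneg (x i), sq_nonneg θ]

/-- A truncation bound for the largest observation. -/
lemma sq_norm_wHat_le (t θ : ℝ) {K : ℝ} (hK : 0 ≤ K) :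
    ‖wHat x t θ‖ ^ 2 ≤
      2 * K + 2 * θ ^ 2 + 2 * ∑ i, {y : ℝ | K < y ^ 2}.indicator (fun y => y ^ 2) (x i) := by
  set T := ∑ i, {y : ℝ | K < y ^ 2}.indicator (fun y => y ^ 2) (x i) with hT
  have hnn : ∀ i, 0 ≤ {y : ℝ | K < y ^ 2}.indicator (fun y => y ^ 2) (x i) := fun i =>
    Set.indicator_nonneg (fun y _ => sq_nonneg y) _
  have hT0 : 0 ≤ T := Finset.sum_nonneg fun i _ => hnn i
  have hR : 0 ≤ 2 * K + 2 * θ ^ 2 + 2 * T := by positivity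
  have : ‖wHat x t θ‖ ≤ √(2 * K + 2 * θ ^ 2 + 2 * T) := by
    refine (pi_norm_le_iff_of_nonneg (Real.sqrt_nonneg _)).2 fun i => Real.abs_le_sqrt ?_
    refine (wHat_sq_le x t θ i).trans ?_
    have hx : x i ^ 2 ≤ K + T := by
      by_cases h : K < x i ^ 2
      · have := Finset.single_le_sum (fun j _ => hnn j) (Finset.mem_univ i)
        rw [Set.indicator_of_mem (by exact h)] at this
        linarith
      · linarith
    linarith
  calc ‖wHat x t θ‖ ^ 2 ≤ √(2 * K + 2 * θ ^ 2 + 2 * T) ^ 2 := by gcongr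
    _ = _ := Real.sq_sqrt hR

end perturbation

/-! ### Limit theorems for the sample -/

/-- The sample `(X 0, …, X (n - 1))` at `ω`, for `z = (n, ω)`. -/
def sample {Ω : Type*} (X : ℕ → Ω → ℝ) (z : ℕ × Ω) : Fin z.1 → ℝ := fun i => X i z.2

/-- The normalized sum `n^(-1/2) ∑ (g(X i) - E g(X))`. -/
def normalizedSum {Ω : Type*} (ν : Measure ℝ) (X : ℕ → Ω → ℝ) (g : ℝ → ℝ) (n : ℕ) (ω : Ω) : ℝ :=
  (∑ i : Fin n, (g (X i ω) - ∫ x, g x ∂ν)) / √n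

section iid

variable {Ω : Type*} [MeasurableSpace Ω] {P : Measure Ω} {ν : Measure ℝ} {X : ℕ → Ω → ℝ}

lemma eventually_whp_pos : ∀ᶠ z in whp P, 0 < z.1 :=
  tendsto_fst_whp.eventually (eventually_gt_atTop 0)

lemma tendsto_whp_inv : Tendsto (fun z : ℕ × Ω => 1 / (z.1 : ℝ)) (whp P) (𝓝 0) :=
  tendsto_one_div_atTop_nhds_zero_nat.comp tendsto_fst_whp

lemma aemeasurable_sample (hlaw : ∀ i, HasLaw (X i) ν P) (n : ℕ) :
    AEMeasurable (fun ω (i : Fin n) => X i ω) P :=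
  aemeasurable_pi_iff.2 fun i => (hlaw i).aemeasurable

lemma identDistrib_comp (hlaw : ∀ i, HasLaw (X i) ν P) {g : ℝ → ℝ} (hg : Measurable g) (i : ℕ) :
    IdentDistrib (fun ω => g (X i ω)) (fun ω => g (X 0 ω)) P P :=
  IdentDistrib.comp (f := X i) (g := X 0)
    ⟨(hlaw i).aemeasurable, (hlaw 0).aemeasurable, (hlaw i).map_eq.trans (hlaw 0).map_eq.symm⟩ hg

lemma integral_comp_eq (hlaw : ∀ i, HasLaw (X i) ν P) {g : ℝ → ℝ} (hg : Measurable g) (i : ℕ) :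
    ∫ ω, g (X i ω) ∂P = ∫ x, g x ∂ν := by
  rw [← (hlaw i).map_eq, integral_map (hlaw i).aemeasurable hg.aestronglyMeasurable]

lemma memLp_comp (hlaw : ∀ i, HasLaw (X i) ν P) {g : ℝ → ℝ} {p : ℝ≥0∞} (hg : MemLp g p ν)
    (i : ℕ) : MemLp (fun ω => g (X i ω)) p P :=
  ((hlaw i).map_eq ▸ hg : MemLp g p (P.map (X i))).comp_of_map (hlaw i).aemeasurable

lemma variance_comp_eq (hlaw : ∀ i, HasLaw (X i) ν P) {g : ℝ → ℝ} (hg : Measurable g) (i : ℕ) :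
    variance (fun ω => g (X i ω)) P = variance g ν := by
  have := variance_map (X := g) (μ := P) (Y := X i) hg.aemeasurable (hlaw i).aemeasurable
  rw [(hlaw i).map_eq] at this
  exact this.symm

variable [IsProbabilityMeasure P]

/-- The law of large numbers for functions of the observations. -/
lemma tendsto_sampleMean (hlaw : ∀ i, HasLaw (X i) ν P) (hindep : iIndepFun X P) {g : ℝ → ℝ}
    (hg : Measurable g) (hint : Integrable g ν) :
    Tendsto (fun z => (∑ i, g (sample X z i)) / z.1) (whp P) (𝓝 (∫ x, g x ∂ν)) := by
  have hind := hindep.comp (fun _ => g) (fun _ => hg)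
  have hslln := strong_law_ae_real (fun i ω => g (X i ω))
    (memLp_one_iff_integrable.1 (memLp_comp hlaw (memLp_one_iff_integrable.2 hint) 0))
    (fun i j hij => hind.indepFun hij) (identDistrib_comp hlaw hg)
  rw [integral_comp_eq hlaw hg] at hslln
  refine tendsto_whp_of_ae (P := P) (f := fun n ω => (∑ i : Fin n, g (X i ω)) / n) (fun n => ?_) ?_
  · exact (Finset.aemeasurable_fun_sum Finset.univ fun (i : Fin n) _ =>
      hg.comp_aemeasurable (hlaw i).aemeasurable).div_const (n : ℝ)
  · filter_upwards [hslln] with ω hω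
    simpa only [Finset.sum_range] using hω

lemma memLp_normalizedSum (hlaw : ∀ i, HasLaw (X i) ν P) {g : ℝ → ℝ} (hg : MemLp g 2 ν) (n : ℕ) :
    MemLp (normalizedSum ν X g n) 2 P := by
  unfold normalizedSum
  simp only [div_eq_mul_inv]
  exact (memLp_finsetSum Finset.univ fun (i : Fin n) _ =>
    (memLp_comp hlaw hg i).sub (memLp_const (∫ x, g x ∂ν))).mul_const (√(n : ℝ))⁻¹

lemma integral_normalizedSum_sq (hlaw : ∀ i, HasLaw (X i) ν P) (hindep : iIndepFun X P)
    {g : ℝ → ℝ} (hgm : Measurable g) (hg : MemLp g 2 ν) {n : ℕ} (hn : 0 < n) :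
    ∫ ω, normalizedSum ν X g n ω ^ 2 ∂P = variance g ν := by
  have hind := hindep.comp (fun _ => g) (fun _ => hgm)
  have hvar := IndepFun.variance_sum (μ := P) (X := fun (i : Fin n) ω => g (X i ω))
    (s := Finset.univ) (fun i _ => memLp_comp hlaw hg i)
    (fun i _ j _ hij => hind.indepFun (fun h => hij (Fin.ext h)))
  simp only [variance_comp_eq hlaw hgm, Finset.sum_const, Finset.card_univ, Fintype.card_fin,
    nsmul_eq_mul] at hvar
  have hmem : MemLp (∑ i : Fin n, fun ω => g (X i ω)) 2 P :=
    memLp_finsetSum' _ fun i _ => memLp_comp hlaw hg i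
  rw [variance_eq_integral hmem.aemeasurable] at hvar
  have hmean : ∫ ω, (∑ i : Fin n, fun ω => g (X i ω)) ω ∂P = n * ∫ x, g x ∂ν := by
    simp only [Finset.sum_apply]
    rw [integral_finsetSum Finset.univ fun (i : Fin n) _ =>
      (memLp_comp hlaw hg i).integrable one_le_two]
    simp [integral_comp_eq hlaw hgm]
  have hn' : (0 : ℝ) < n := by positivity
  have heq : ∀ ω, normalizedSum ν X g n ω ^ 2 =
      ((∑ i : Fin n, fun ω => g (X i ω)) ω - n * ∫ x, g x ∂ν) ^ 2 / n := fun ω => by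
    simp only [normalizedSum, div_pow, Real.sq_sqrt hn'.le, Finset.sum_sub_distrib,
      Finset.sum_apply, Finset.sum_const, Finset.card_univ, Fintype.card_fin, nsmul_eq_mul]
  simp only [heq]
  rw [integral_div, ← hmean, hvar]
  field_simp

/-- The central limit theorem for functions of the observations. -/
lemma tendstoInDistribution_normalizedSum (hlaw : ∀ i, HasLaw (X i) ν P) (hindep : iIndepFun X P)
    {g : ℝ → ℝ} (hgm : Measurable g) (hg : MemLp g 2 ν) :
    TendstoInDistribution (normalizedSum ν X g) atTop (fun x => √(variance g ν) * x)
      (fun _ => P) (gaussianReal 0 1) := by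
  have hind : iIndepFun (fun i ω => g (X i ω)) P := hindep.comp (fun _ => g) (fun _ => hgm)
  have hY : HasLaw (fun x : ℝ => √(variance g ν) * x)
      (gaussianReal 0 (variance (fun ω => g (X 0 ω)) P).toNNReal) (gaussianReal 0 1) := by
    have := gaussianReal_const_mul (HasLaw.id (μ := gaussianReal 0 1)) (√(variance g ν))
    convert this using 2
    · simp
    · simp
    · rw [variance_comp_eq hlaw hgm, mul_one]
      refine NNReal.coe_injective ?_
      rw [Real.coe_toNNReal _ (variance_nonneg g ν)]
      exact (Real.sq_sqrt (variance_nonneg g ν)).symm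
  have h := tendstoInDistribution_inv_sqrt_mul_sum_sub (X := fun i ω => g (X i ω)) hY
    (memLp_comp hlaw hg 0) hind (identDistrib_comp hlaw hgm)
  have heq : normalizedSum ν X g = fun (n : ℕ) ω => (√n)⁻¹ *
      (∑ k ∈ Finset.range n, g (X k ω) - n * ∫ ω, g (X 0 ω) ∂P) := by
    ext n ω
    simp only [normalizedSum, Finset.sum_sub_distrib, Finset.sum_const,
      Finset.card_univ, Fintype.card_fin, nsmul_eq_mul, Finset.sum_range,
      integral_comp_eq hlaw hgm]
    rw [inv_mul_eq_div]
  rw [heq]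
  exact h

/-- After truncation at a fixed level `K`, the squared maximum over `n` is at most `O(1/n)` plus
twice the sample mean of `x² 1(x² > K)`. By the law of large numbers that mean is close to a tail
integral, small for large `K`. -/
lemma tendsto_norm_wHat_div_sqrt (hlaw : ∀ i, HasLaw (X i) ν P) (hindep : iIndepFun X P)
    (hsq : Integrable (fun x : ℝ => x ^ 2) ν) (t θ : ℝ) :
    Tendsto (fun z => ‖wHat (sample X z) t θ‖ / √z.1) (whp P) (𝓝 0) := by
  have hset : ∀ K : ℝ, MeasurableSet {y : ℝ | K < y ^ 2} := fun K =>
    measurableSet_lt measurable_const (by fun_prop)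
  have htail : Tendsto (fun k : ℕ => ∫ x, {y : ℝ | (k : ℝ) < y ^ 2}.indicator (fun y => y ^ 2) x ∂ν)
      atTop (𝓝 0) := by
    rw [← integral_zero ℝ ℝ (μ := ν)]
    refine tendsto_integral_of_dominated_convergence (fun x => x ^ 2) (fun k => ?_) hsq
      (fun k => ae_of_all _ fun x => ?_) (ae_of_all _ fun x => ?_)
    · exact (hsq.indicator (hset k)).aestronglyMeasurable
    · rw [Real.norm_eq_abs, abs_of_nonneg (Set.indicator_nonneg (fun y _ => sq_nonneg y) _)]
      exact Set.indicator_le_self' (fun y _ => sq_nonneg y) _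
    · refine tendsto_const_nhds.congr' ?_
      obtain ⟨N, hN⟩ := exists_nat_ge (x ^ 2)
      filter_upwards [eventually_ge_atTop N] with k hk
      rw [Set.indicator_of_notMem]
      have : (N : ℝ) ≤ k := by exact_mod_cast hk
      simp only [Set.mem_ofPred_eq, not_lt]
      linarith
  rw [Metric.tendsto_nhds]
  intro ε hε
  -- The tail mean enters `sq_norm_wHat_le` with factor two, so it uses up `ε² / 2`; the truncated
  -- part uses the other half.
  obtain ⟨k, hk⟩ := (htail.eventually (gt_mem_nhds (show 0 < ε ^ 2 / 4 by positivity))).exists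
  have hmean := tendsto_sampleMean hlaw hindep
    (g := {y : ℝ | (k : ℝ) < y ^ 2}.indicator (fun y => y ^ 2))
    ((by fun_prop : Measurable fun y : ℝ => y ^ 2).indicator (hset k)) (hsq.indicator (hset k))
  have hinv := (tendsto_whp_inv (P := P)).const_mul (2 * (k : ℝ) + 2 * θ ^ 2)
  rw [mul_zero] at hinv
  filter_upwards [eventually_whp_pos, hmean.eventually (gt_mem_nhds hk),
    hinv.eventually (gt_mem_nhds (show 0 < ε ^ 2 / 2 by positivity))] with z hz h1 h2
  have hn : (0 : ℝ) < z.1 := by exact_mod_cast hz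
  rw [dist_zero_right, Real.norm_of_nonneg (by positivity)]
  refine lt_of_pow_lt_pow_left₀ 2 hε.le ?_
  rw [div_pow, Real.sq_sqrt hn.le, div_lt_iff₀ hn]
  rw [div_lt_iff₀ hn] at h1
  rw [mul_one_div, div_lt_iff₀ hn] at h2
  have := sq_norm_wHat_le (sample X z) t θ (K := k) k.cast_nonneg
  linarith

variable [IsProbabilityMeasure ν]

/-- Almost surely, no two observations coincide in a set without atoms. -/
lemma ae_ne_of_measure_singleton (hlaw : ∀ i, HasLaw (X i) ν P) (hindep : iIndepFun X P)
    {U : Set ℝ} (hU : MeasurableSet U) (hν : ∀ x ∈ U, ν {x} = 0) :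
    ∀ᵐ ω ∂P, ∀ i j, X i ω ∈ U → X i ω = X j ω → i = j := by
  rw [ae_all_iff]
  intro i
  rw [ae_all_iff]
  intro j
  rcases eq_or_ne i j with hij | hij
  · exact ae_of_all _ fun _ _ _ => hij
  have hmap := (hindep.indepFun hij).map_prod_eq_prod_map_map (hlaw i).aemeasurable
    (hlaw j).aemeasurable
  rw [(hlaw i).map_eq, (hlaw j).map_eq] at hmap
  set s : Set (ℝ × ℝ) := {p | p.1 = p.2} ∩ Prod.fst ⁻¹' U with hs
  have hsm : MeasurableSet s :=
    (measurableSet_eq_fun measurable_fst measurable_snd).inter (measurable_fst hU)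
  have h0 : P.map (fun ω => (X i ω, X j ω)) s = 0 := by
    rw [hmap, Measure.measure_prod_null hsm]
    refine ae_of_all _ fun x => ?_
    by_cases hx : x ∈ U
    · exact measure_mono_null (fun y hy => (show x = y from hy.1).symm) (hν x hx)
    · refine measure_mono_null (fun y hy => ?_) (measure_empty (μ := ν))
      exact hx hy.2
  rw [Measure.map_apply_of_aemeasurable
    ((hlaw i).aemeasurable.prodMk (hlaw j).aemeasurable) hsm] at h0
  refine measure_mono_null (fun ω hω => ?_) h0
  by_contra hcon
  exact hω fun hiU hij' => absurd (⟨hij', hiU⟩ : (X i ω, X j ω) ∈ s) hcon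

lemma tendsto_empCdf (hlaw : ∀ i, HasLaw (X i) ν P) (hindep : iIndepFun X P) (y : ℝ) :
    Tendsto (fun z => empCdf (sample X z) y) (whp P) (𝓝 (cdf ν y)) := by
  have := tendsto_sampleMean hlaw hindep (g := (Set.Iic y).indicator 1)
    (measurable_one.indicator measurableSet_Iic)
    ((integrable_const (1 : ℝ)).indicator measurableSet_Iic)
  rw [integral_indicator_one measurableSet_Iic, ← cdf_eq_real] at this
  simpa only [empCdf_eq_sum] using this

section quantile

variable {t : ℝ} (hlaw : ∀ i, HasLaw (X i) ν P) (hindep : iIndepFun X P) (ht : 0 < t) (ht1 : t < 1)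
  (hcont : ∀ᶠ x in 𝓝 (quantile ν t), ContinuousAt (fun y => cdf ν y) x)
  (huniq : ∀ x, quantile ν t < x → t < cdf ν x)

include hlaw hindep ht ht1 huniq

/-- Only the law of large numbers at fixed points on either side of `ψ` is needed, because `F` is
strictly below `t` to the left and, by `huniq`, strictly above `t` to the right. -/
lemma tendsto_sampleQuantile :
    Tendsto (fun z => sampleQuantile (sample X z) t) (whp P) (𝓝 (quantile ν t)) := by
  rw [tendsto_order]
  refine ⟨fun a ha => ?_, fun b hb => ?_⟩
  · filter_upwards [eventually_whp_pos, (tendsto_empCdf hlaw hindep a).eventually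
      (gt_mem_nhds (cdf_lt_of_lt_quantile ht ha))] with z hz hlt
    exact not_le.1 fun h => absurd ((sampleQuantile_le_iff hz ht ht1.le).1 h) (not_le.2 hlt)
  · obtain ⟨c, hc, hcb⟩ := exists_between hb
    filter_upwards [eventually_whp_pos, (tendsto_empCdf hlaw hindep c).eventually
      (lt_mem_nhds (huniq c hc))] with z hz hlt
    exact ((sampleQuantile_le_iff hz ht ht1.le).2 hlt.le).trans_lt hcb

include hcont

/-- Continuity of `F` near `ψ` rules out atoms, hence almost surely ties, in a ball which contains
`ψ̂` with probability tending to one. -/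
lemma eventually_abs_empCdf_sampleQuantile_sub_le :
    ∀ᶠ z in whp P, |empCdf (sample X z) (sampleQuantile (sample X z) t) - t| ≤ 1 / z.1 := by
  obtain ⟨ε, hε, hball⟩ := Metric.eventually_nhds_iff_ball.1 hcont
  have hties := eventually_whp_of_ae (P := P)
    (p := fun z => ∀ i j, X i z.2 ∈ Metric.ball (quantile ν t) ε → X i z.2 = X j z.2 → i = j)
    ((ae_ne_of_measure_singleton hlaw hindep measurableSet_ball fun x hx =>
      measure_singleton_of_continuousAt_cdf (hball x hx)).mono fun ω h _ => h)
  filter_upwards [eventually_whp_pos, hties,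
    (tendsto_sampleQuantile hlaw hindep ht ht1 huniq).eventually (Metric.ball_mem_nhds _ hε)]
    with z hz hz' hq
  have h1 := le_empCdf_sampleQuantile hz ht ht1.le (sample X z)
  have h2 := empCdf_sampleQuantile_le (x := sample X z) hz ht ht1.le fun i j hi hj =>
    Fin.ext (hz' i j (by rw [show X i z.2 = _ from hi]; exact hq) (hi.trans hj.symm))
  rw [abs_of_nonneg (by linarith)]
  linarith

/-- Both values tend to `t`, so no uniform convergence of the empirical distribution function is
required. -/
lemma tendsto_empCdf_sampleQuantile_sub :
    Tendsto (fun z => |empCdf (sample X z) (sampleQuantile (sample X z) t) -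
      empCdf (sample X z) (quantile ν t)|) (whp P) (𝓝 0) := by
  have h1 : Tendsto (fun z => empCdf (sample X z) (sampleQuantile (sample X z) t) - t) (whp P)
      (𝓝 0) := squeeze_zero_norm'
    (eventually_abs_empCdf_sampleQuantile_sub_le hlaw hindep ht ht1 hcont huniq) tendsto_whp_inv
  have h2 := (tendsto_empCdf hlaw hindep (quantile ν t)).sub_const t
  rw [cdf_quantile ht hcont.self_of_nhds huniq, sub_self] at h2
  have := (h1.sub h2).abs
  simpa using this

/-- The normalized sum of the `Ŵ_i` is asymptotically equivalent to that of
`(X_i - ψ) 1(X_i ≤ ψ)`. -/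
lemma tendsto_sum_wHat_sub_normalizedSum (hsq : Integrable (fun x : ℝ => x ^ 2) ν) :
    Tendsto (fun z => (∑ i, wHat (sample X z) t (lorenz ν t) i) / √z.1 - normalizedSum ν X
      ((Set.Iic (quantile ν t)).indicator (fun x => x - quantile ν t)) z.1 z.2)
      (whp P) (𝓝 0) := by
  set ψ := quantile ν t with hψ
  have hq := cdf_quantile ht hcont.self_of_nhds huniq
  set g : ℝ → ℝ := (Set.Iic ψ).indicator 1 with hg
  have hgm : Measurable g := measurable_one.indicator measurableSet_Iic
  have hgL : MemLp g 2 ν := (memLp_const 1).indicator measurableSet_Iic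
  have hgint : ∫ x, g x ∂ν = t := by
    rw [hg, integral_indicator_one measurableSet_Iic, ← cdf_eq_real, hq]
  rw [Metric.tendsto_nhds]
  intro ε hε
  have hqt := tendsto_sampleQuantile hlaw hindep ht ht1 huniq
  have hsqrt : Tendsto (fun z : ℕ × Ω => 1 / √(z.1 : ℝ)) (whp P) (𝓝 0) := by
    have := (Real.continuous_sqrt.tendsto 0).comp (tendsto_whp_inv (P := P))
    simpa [Function.comp_def] using this
  -- Here `q = (ψ̂, 1/√n)` and `Y = √n (F̂(ψ) - t)`; `R` says that the linearization error divided
  -- by `√n` is below `ε`. Its bound vanishes at `q = (ψ, 0)` for every `y`.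
  have hsmall := eventually_whp_of_secondMoment (P := P) (Y := normalizedSum ν X g)
    (C := variance g ν) (hqt.prodMk_nhds hsqrt) (fun n _ => memLp_normalizedSum hlaw hgL n)
    (fun n hn => (integral_normalizedSum_sq hlaw hindep hgm hgL hn).le)
    (R := fun q y => |q.1 - ψ| * (q.2 + |y|) + |ψ| * q.2 < ε) (fun y => by
      have hc : ContinuousAt (fun z : (ℝ × ℝ) × ℝ =>
          |z.1.1 - ψ| * (z.1.2 + |z.2|) + |ψ| * z.1.2) ((ψ, 0), y) := by fun_prop
      exact hc.eventually (gt_mem_nhds (by simpa using hε)))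
  filter_upwards [eventually_whp_pos, hsmall,
    eventually_abs_empCdf_sampleQuantile_sub_le hlaw hindep ht ht1 hcont huniq] with z hz hlt hF
  rw [dist_zero_right, Real.norm_eq_abs]
  refine lt_of_le_of_lt ?_ hlt
  have hn : (0 : ℝ) < z.1 := by exact_mod_cast hz
  have hs : 0 < √(z.1 : ℝ) := Real.sqrt_pos.2 hn
  have hss : √(z.1 : ℝ) * √(z.1 : ℝ) = z.1 := Real.mul_self_sqrt hn.le
  have hG : normalizedSum ν X g z.1 z.2 = √z.1 * (empCdf (sample X z) ψ - t) := by
    have := sum_indicator_Iic_eq (sample X z) hz ψ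
    simp only [sample] at this
    rw [normalizedSum, Finset.sum_sub_distrib, hgint, hg, this, div_eq_iff hs.ne']
    simp only [Finset.sum_const, Finset.card_univ, Fintype.card_fin, nsmul_eq_mul, ← mul_sub]
    rw [mul_right_comm, hss]
  have hmain := abs_sum_wHat_sub_le (sample X z) hz t (lorenz ν t) ψ
  rw [normalizedSum, ← sub_div, integral_indicator_sub_quantile hsq hq, abs_div, abs_of_pos hs,
    div_le_iff₀ hs]
  refine hmain.trans ?_
  set F := empCdf (sample X z) (sampleQuantile (sample X z) t)
  have htri : |F - empCdf (sample X z) ψ| ≤ 1 / z.1 + |empCdf (sample X z) ψ - t| := by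
    have := abs_sub_le F t (empCdf (sample X z) ψ)
    rw [abs_sub_comm t] at this
    linarith
  calc z.1 * (|sampleQuantile (sample X z) t - ψ| * |F - empCdf (sample X z) ψ| + |ψ| * |F - t|)
      ≤ z.1 * (|sampleQuantile (sample X z) t - ψ| *
          (1 / z.1 + |empCdf (sample X z) ψ - t|) + |ψ| * (1 / z.1)) := by gcongr
    _ = (|sampleQuantile (sample X z) t - ψ| * (1 / √z.1 + |normalizedSum ν X g z.1 z.2|) +
          |ψ| * (1 / √z.1)) * √z.1 := by
        have key : ∀ {n s a b c : ℝ}, 0 < s → s * s = n →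
            n * (a * (1 / n + b) + c * (1 / n)) = (a * (1 / s + s * b) + c * (1 / s)) * s := by
          rintro _ s a b c hs rfl
          field_simp
        rw [hG, abs_mul, abs_of_pos hs, key hs hss]

lemma tendsto_mean_wHat_sq (hsq : Integrable (fun x : ℝ => x ^ 2) ν) :
    Tendsto (fun z => (∑ i, wHat (sample X z) t (lorenz ν t) i ^ 2) / z.1) (whp P)
      (𝓝 (sigmaPSq ν t)) := by
  set ψ := quantile ν t with hψ
  set θ := lorenz ν t with hθ
  have hk : MemLp ((Set.Iic ψ).indicator (fun x => x)) 2 ν := memLp_indicator_id hsq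
  have hkm : Measurable ((Set.Iic ψ).indicator (fun x : ℝ => x)) :=
    measurable_id.indicator measurableSet_Iic
  have hlim := tendsto_sampleMean hlaw hindep
    (g := fun x => ((Set.Iic ψ).indicator (fun x => x) x - θ) ^ 2) (by fun_prop)
    (hk.sub (memLp_const θ)).integrable_sq
  have hvar : ∫ x, ((Set.Iic ψ).indicator (fun x => x) x - θ) ^ 2 ∂ν = sigmaPSq ν t := by
    rw [sigmaPSq, variance_eq_integral hkm.aemeasurable]
    rfl
  rw [hvar] at hlim
  have hdiff : Tendsto (fun z => (∑ i, wHat (sample X z) t θ i ^ 2) / z.1 -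
      (∑ i, ((Set.Iic ψ).indicator (fun x => x) (sample X z i) - θ) ^ 2) / z.1) (whp P) (𝓝 0) := by
    have hF := (tendsto_empCdf_sampleQuantile_sub hlaw hindep ht ht1 hcont huniq).const_mul
      ((|ψ| + 1) * (|ψ| + 1 + 2 * |θ|))
    rw [mul_zero] at hF
    refine squeeze_zero_norm' ?_ hF
    filter_upwards [eventually_whp_pos, (tendsto_sampleQuantile hlaw hindep ht ht1
      huniq).eventually (Metric.closedBall_mem_nhds _ one_pos)] with z hz hq
    exact abs_sum_wHat_sq_sub_le (sample X z) hz t θ ψ hq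
  simpa using hdiff.add hlim

end quantile

end iid

/-! ### The transformed statistic -/

/-- If `B n → N(0, v)` in distribution, then extended-real variables asymptotically equivalent to
`B n ^ 2 / v` converge in distribution to the chi-squared law. -/
lemma tendstoInDistribution_chiSquaredOne {Ω : Type*} [MeasurableSpace Ω]
    {P : Measure Ω} [IsProbabilityMeasure P] {B : ℕ → Ω → ℝ} {stat : ℕ → Ω → EReal} {v : ℝ}
    (hv : 0 < v)
    (hB : TendstoInDistribution B atTop (fun x => √v * x) (fun _ => P) (gaussianReal 0 1))
    (hmeas : ∀ n, AEMeasurable (stat n) P)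
    (hclose : ∀ ε > 0, ∀ᶠ z in whp P, ∃ s : ℝ, stat z.1 z.2 = (s : EReal) ∧
      |s - B z.1 z.2 ^ 2 / v| < ε) :
    TendstoInDistribution stat atTop (fun x : ℝ => (x : EReal)) (fun _ => P) chiSquaredOne := by
  have hsqr : TendstoInDistribution (fun n ω => B n ω ^ 2 / v) atTop
      (fun x => (√v * x) ^ 2 / v) (fun _ => P) (gaussianReal 0 1) :=
    hB.continuous_comp (g := fun y : ℝ => y ^ 2 / v) (by fun_prop)
  -- Slutsky's argument needs subtraction, so it is run on the real parts; the statistic is finite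
  -- with probability tending to one, which carries the limit back to `EReal`.
  have hdiff : Tendsto (fun z : ℕ × Ω => (stat z.1 z.2).toReal - B z.1 z.2 ^ 2 / v)
      (whp P) (𝓝 0) := by
    rw [Metric.tendsto_nhds]
    intro ε hε
    filter_upwards [hclose ε hε] with z hz
    obtain ⟨s, hs, hsε⟩ := hz
    simpa [hs, Real.dist_eq] using hsε
  have hmeasure : TendstoInMeasure P
      ((fun n ω => (stat n ω).toReal) - fun n ω => B n ω ^ 2 / v) atTop 0 :=
    tendsto_whp_iff.1 hdiff
  have hreal' : ∀ n, AEMeasurable (fun ω => (stat n ω).toReal) P :=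
    fun n => (hmeas n).ereal_toReal
  have hreal := tendstoInDistribution_of_tendstoInMeasure_sub (fun n ω => (stat n ω).toReal) _ hsqr
    hmeasure hreal'
  have hE := tendstoInDistribution_congr_whp
    (hreal.continuous_comp (g := fun y : ℝ => (y : EReal)) continuous_coe_real_ereal) hmeas (by
      filter_upwards [hclose 1 one_pos] with z hz
      obtain ⟨s, hs, -⟩ := hz
      simp [hs])
  have hlim : (gaussianReal 0 1).map ((fun y : ℝ => (y : EReal)) ∘
      (fun y : ℝ => y ^ 2 / v) ∘ fun x => √v * x) =
      chiSquaredOne.map (fun x : ℝ => (x : EReal)) := by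
    rw [chiSquaredOne, Measure.map_map measurable_coe_real_ereal (by fun_prop)]
    congr 1
    ext x
    simp only [Function.comp_apply, mul_pow]
    rw [Real.sq_sqrt hv.le, mul_div_cancel_left₀ _ hv.ne']
  refine ⟨hmeas, measurable_coe_real_ereal.aemeasurable,
    ProbabilityMeasure.tendsto_iff_forall_integral_tendsto.2 fun f => ?_⟩
  have ht := ProbabilityMeasure.tendsto_iff_forall_integral_tendsto.1 hE.tendsto f
  simp only [ProbabilityMeasure.coe_mk] at ht ⊢
  rw [← hlim]
  exact ht

/-- For `q = (A, m, 1 / n, r)` and `B = b + r`, the bounds of `exists_logRatio_eq` apply and force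
the scaled transformed statistic to be within `ε` of `b² / v`. -/
def ForcesClose (a v ε : ℝ) (q : ℝ × ℝ × ℝ × ℝ) (b : ℝ) : Prop :=
  0 < q.1 - (b + q.2.2.2) ^ 2 * q.2.2.1 ∧
  |b + q.2.2.2| * q.2.1 / (q.1 - (b + q.2.2.2) ^ 2 * q.2.2.1) ≤ 1 / 4 ∧
  ∀ l : ℝ, (b + q.2.2.2) ^ 2 / q.1 * (1 - 4 * (|b + q.2.2.2| * q.2.1 / q.1)) ≤ l →
    l ≤ (b + q.2.2.2) ^ 2 / (q.1 - (b + q.2.2.2) ^ 2 * q.2.2.1) *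
      (1 + 8 * (|b + q.2.2.2| * q.2.1 / (q.1 - (b + q.2.2.2) ^ 2 * q.2.2.1))) →
    |a / v * (l * max (1 - l * q.2.2.1) (1 / 2)) - b ^ 2 / v| < ε

lemma eventually_forcesClose {a v ε : ℝ} (ha : 0 < a) (hε : 0 < ε) (b : ℝ) :
    ∀ᶠ z : (ℝ × ℝ × ℝ × ℝ) × ℝ in 𝓝 ((a, 0, 0, 0), b), ForcesClose a v ε z.1 z.2 := by
  set z₀ : (ℝ × ℝ × ℝ × ℝ) × ℝ := ((a, 0, 0, 0), b) with hz₀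
  have hB : Tendsto (fun z : (ℝ × ℝ × ℝ × ℝ) × ℝ => z.2 + z.1.2.2.2) (𝓝 z₀) (𝓝 b) :=
    (by fun_prop : Continuous fun z : (ℝ × ℝ × ℝ × ℝ) × ℝ => z.2 + z.1.2.2.2).tendsto' _ _
      (by simp [hz₀])
  have hA : Tendsto (fun z : (ℝ × ℝ × ℝ × ℝ) × ℝ => z.1.1) (𝓝 z₀) (𝓝 a) :=
    (by fun_prop : Continuous fun z : (ℝ × ℝ × ℝ × ℝ) × ℝ => z.1.1).tendsto' _ _ rfl
  have hm : Tendsto (fun z : (ℝ × ℝ × ℝ × ℝ) × ℝ => z.1.2.1) (𝓝 z₀) (𝓝 0) :=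
    (by fun_prop : Continuous fun z : (ℝ × ℝ × ℝ × ℝ) × ℝ => z.1.2.1).tendsto' _ _ rfl
  have hκ : Tendsto (fun z : (ℝ × ℝ × ℝ × ℝ) × ℝ => z.1.2.2.1) (𝓝 z₀) (𝓝 0) :=
    (by fun_prop : Continuous fun z : (ℝ × ℝ × ℝ × ℝ) × ℝ => z.1.2.2.1).tendsto' _ _ rfl
  have hD := hA.sub ((hB.pow 2).mul hκ)
  rw [mul_zero, sub_zero] at hD
  have huA := (hB.abs.mul hm).div hA ha.ne'
  have huD := (hB.abs.mul hm).div hD ha.ne'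
  have hlo := ((hB.pow 2).div hA ha.ne').mul (tendsto_const_nhds (x := (1 : ℝ)).sub
    (huA.const_mul 4))
  have hup := ((hB.pow 2).div hD ha.ne').mul (tendsto_const_nhds (x := (1 : ℝ)).add
    (huD.const_mul 8))
  simp only [mul_zero, zero_div, sub_zero, add_zero, mul_one] at huA huD hlo hup
  have hb : Tendsto (fun z : (ℝ × ℝ × ℝ × ℝ) × ℝ => z.2) (𝓝 z₀) (𝓝 b) :=
    (by fun_prop : Continuous fun z : (ℝ × ℝ × ℝ × ℝ) × ℝ => z.2).tendsto' _ _ rfl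
  -- The lower and upper bounds for `l` both tend to `b² / a`. There, with `1 / n` replaced by its
  -- limit `0`, the correction factor is `1` and the error vanishes.
  have hφ : Tendsto (fun y : ℝ × ℝ × ℝ => |a / v * (y.1 * max (1 - y.1 * y.2.1) (1 / 2)) -
      y.2.2 ^ 2 / v|) (𝓝 (b ^ 2 / a, 0, b)) (𝓝 0) := by
    refine Continuous.tendsto' (by fun_prop) _ _ ?_
    rw [abs_eq_zero, mul_zero, sub_zero, max_eq_left (by norm_num)]
    field_simp
    simp
  have hev := hφ.eventually (gt_mem_nhds hε)
  rw [nhds_prod_eq, Filter.eventually_prod_iff] at hev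
  obtain ⟨p, hp, q, hq, hpq⟩ := hev
  obtain ⟨η, hη, hpη⟩ := Metric.eventually_nhds_iff.1 hp
  filter_upwards [hD.eventually (lt_mem_nhds ha), huD.eventually (gt_mem_nhds (by norm_num :
    (0 : ℝ) < 1 / 4)), hlo.eventually (lt_mem_nhds (sub_lt_self (b ^ 2 / a) hη)),
    hup.eventually (gt_mem_nhds (lt_add_of_pos_right (b ^ 2 / a) hη)),
    (hκ.prodMk_nhds hb).eventually hq] with z h1 h2 h3 h4 h5
  refine ⟨h1, h2.le, fun l hl1 hl2 => hpq (hpη ?_) h5⟩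
  rw [Real.dist_eq, abs_lt]
  constructor
  · linarith [h3.trans_le hl1]
  · linarith [hl2.trans_lt h4]

lemma mul_transformedLogELRatio_eq {n : ℕ} {x : Fin n → ℝ} {t θ l : ℝ} (ρ : ℝ)
    (h : logELRatio x t θ = (l : EReal)) :
    (ρ : EReal) * transformedLogELRatio x t θ =
      ((ρ * (l * max (1 - l * (1 / n)) (1 / 2)) : ℝ) : EReal) := by
  have hdiv : (l : EReal) / (n : EReal) = ((l / n : ℝ) : EReal) := by
    rw [EReal.coe_div]
    rfl
  have hsub : (1 : EReal) - ((l / n : ℝ) : EReal) = ((1 - l / n : ℝ) : EReal) := by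
    rw [EReal.coe_sub]
    rfl
  rw [transformedLogELRatio, h, hdiv, hsub, mul_one_div, 
    ← EReal.coe_strictMono.monotone.map_max, ← EReal.coe_mul, ← EReal.coe_mul]

/-- With probability tending to one, the scaled transformed statistic is within `ε` of the squared
normalized sum of `(X_i - ψ) 1(X_i ≤ ψ)`, divided by `σ_v²`. -/
lemma eventually_exists_mul_transformedLogELRatio_eq {Ω : Type*} [MeasurableSpace Ω]
    {P : Measure Ω} [IsProbabilityMeasure P] {ν : Measure ℝ} [IsProbabilityMeasure ν]
    {X : ℕ → Ω → ℝ} {t : ℝ} (hlaw : ∀ i, HasLaw (X i) ν P) (hindep : iIndepFun X P)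
    (ht : 0 < t) (ht1 : t < 1)
    (hcont : ∀ᶠ x in 𝓝 (quantile ν t), ContinuousAt (fun y => cdf ν y) x)
    (huniq : ∀ x, quantile ν t < x → t < cdf ν x) (hsq : Integrable (fun x : ℝ => x ^ 2) ν)
    {ε : ℝ} (hε : 0 < ε) :
    ∀ᶠ z in whp P, ∃ s : ℝ, ((sigmaPSq ν t / sigmaVSq ν t : ℝ) : EReal) *
        transformedLogELRatio (sample X z) t (lorenz ν t) = (s : EReal) ∧
      |s - normalizedSum ν X ((Set.Iic (quantile ν t)).indicator (fun x => x - quantile ν t))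
        z.1 z.2 ^ 2 / sigmaVSq ν t| < ε := by
  have hhm : Measurable ((Set.Iic (quantile ν t)).indicator (fun x => x - quantile ν t)) :=
    (measurable_id.sub_const _).indicator measurableSet_Iic
  have hhL := memLp_indicator_sub (t := t) hsq (quantile ν t)
  have hq := (tendsto_mean_wHat_sq hlaw hindep ht ht1 hcont huniq hsq).prodMk_nhds
    ((tendsto_norm_wHat_div_sqrt hlaw hindep hsq t (lorenz ν t)).prodMk_nhds
      ((tendsto_whp_inv (P := P)).prodMk_nhds
        (tendsto_sum_wHat_sub_normalizedSum hlaw hindep ht ht1 hcont huniq hsq)))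
  filter_upwards [eventually_whp_pos, eventually_whp_of_secondMoment
    (R := ForcesClose (sigmaPSq ν t) (sigmaVSq ν t) ε) hq
    (fun n _ => memLp_normalizedSum hlaw hhL n)
    (fun n hn => (integral_normalizedSum_sq hlaw hindep hhm hhL hn).le)
    (eventually_forcesClose (sigmaPSq_pos hsq ht ht1 hcont.self_of_nhds huniq) hε)] with z hz hR
  simp only [ForcesClose, add_sub_cancel] at hR
  obtain ⟨hD, hsmall, hl⟩ := hR
  obtain ⟨l, hlog, hl1, hl2⟩ := exists_logRatio_eq
    (w := wHat (sample X z) t (lorenz ν t)) hz rfl rfl rfl (by rw [mul_one_div]) hD hsmall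
  exact ⟨_, mul_transformedLogELRatio_eq _ hlog, hl l hl1 hl2⟩

end LorenzEL

end

theorem theorem2p3 {Ω : Type*} [MeasurableSpace Ω] (P : Measure Ω) [IsProbabilityMeasure P]
    (ν : Measure ℝ) [IsProbabilityMeasure ν] (X : ℕ → Ω → ℝ)
    -- `X 0, X 1, …` are independent with common law `ν`
    (hlaw : ∀ i, HasLaw (X i) ν P) (hindep : iIndepFun X P)
    (hsq : Integrable (fun x : ℝ => x ^ 2) ν)
    (t₀ : ℝ) (ht₀ : t₀ ∈ Set.Ioo (0 : ℝ) 1)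
    -- the distribution function is continuous near the `t₀`-quantile, and that quantile is unique
    (hcont : ∀ᶠ x in 𝓝 (LorenzEL.quantile ν t₀), ContinuousAt (fun y => cdf ν y) x)
    (huniq : ∀ x, LorenzEL.quantile ν t₀ < x → t₀ < cdf ν x) :
    TendstoInDistribution
      (fun (n : ℕ) (ω : Ω) =>
        ((LorenzEL.sigmaPSq ν t₀ / LorenzEL.sigmaVSq ν t₀ : ℝ) : EReal) *
          LorenzEL.transformedLogELRatio (fun i : Fin n => X i ω) t₀ (LorenzEL.lorenz ν t₀))
      atTop (fun x : ℝ => (x : EReal)) (fun _ => P) LorenzEL.chiSquaredOne := by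
  obtain ⟨ht, ht1⟩ := ht₀
  have hhm : Measurable
      ((Set.Iic (LorenzEL.quantile ν t₀)).indicator (fun x => x - LorenzEL.quantile ν t₀)) :=
    (measurable_id.sub_const _).indicator measurableSet_Iic
  exact LorenzEL.tendstoInDistribution_chiSquaredOne
    (LorenzEL.sigmaVSq_pos hsq ht ht1 hcont.self_of_nhds huniq)
    (LorenzEL.tendstoInDistribution_normalizedSum hlaw hindep hhm
      (LorenzEL.memLp_indicator_sub (t := t₀) hsq (LorenzEL.quantile ν t₀)))
    (fun n => ((LorenzEL.measurable_transformedLogELRatio ht ht1.le _).const_mul _).comp_aemeasurable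
      (LorenzEL.aemeasurable_sample hlaw n))
    (fun ε hε => LorenzEL.eventually_exists_mul_transformedLogELRatio_eq hlaw hindep ht ht1 hcont
      huniq hsq hε)
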